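/- Let $K$ be a field and let $G$ be an unmixed bipartite graph (all minimal vertex covers have the same cardinality) with vertex set $\{x_1,\dots,x_n\}\cup\{y_1,\dots,y_n\}$, every edge joining some $x_i$ to some $y_j$, labelled so that $\{x_i,y_i\}$ is an edge for every $i$. Let $\mathcal L_G$ be the set of all $\{i : x_i\in C\}\subseteq[n]$, where $C$ runs over the minimal vertex covers of $G$. Ordered by inclusion, it is a lattice whose meet is intersection. In $R=K[x_1,\dots,x_n,y_1,\dots,y_n]$ put $X_A=\prod_{i\in A}x_i$, $Y_A=\prod_{i\in A}y_i$, $u_p=X_pY_{[n]\setminus p}$, and let $H_{\mathcal L_G}$ be the ideal generated by the $u_p$, $p\in\mathcal L_G$. For $p\in\mathcal L_G$ let $N(p)$ be the set of lower neighbours of $p$ in $\mathcal L_G$. Let $\prec$ be a total order on $\mathcal L_G$ that extends the rank order ($\operatorname{rank}p<\operatorname{rank}q$ implies $p\prec q$, where $\operatorname{rank}p$ is the maximal length of a chain in $\mathcal L_G$ descending from $p$). For $i\ge 0$ let $F_i$ be the free $R$-module with basis elements $b(p;S)$, $p\in\mathcal L_G$, $S\subseteq N(p)$, $|S|=i$,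 where $b(p;S)$ has the multidegree of the least common multiple of $u_p$ and all $u_q$, $q\in S$. For $q\in S\subseteq N(p)$ put $\sigma(q;S)=|\{r\in S : r\prec q\}|$, $S_q=\big(\bigwedge_{r\in S\setminus\{q\}}r\big)\setminus q$, where the empty meet is $p$, and $q\wedge T=\{q\wedge t : t\in T\}$. If $T=S\setminus\{q\}=\{t_1\prec\dots\prec t_k\}$, then $q\wedge T$ is a subset of $N(q)$ with $k$ elements, and we write $$b(q;q\wedge t_1,\dots,q\wedge t_k)=(-1)^{\nu}\,b(q;q\wedge T),\qquad \nu=|\{(j,l) : j<l,\ q\wedge t_l\prec q\wedge t_j\}|.$$ (a) There is a minimal multigraded free resolution $\cdots\to F_1\to F_0\to H_{\mathcal L_G}\to0$ whose augmentation maps $b(p;\emptyset)$ to $u_p$ and whose differential is given, for all $p\in\mathcal L_G$ and all non-empty $S\subseteq N(p)$ with $S\setminus\{q\}=\{t_1\prec\dots\prec t_k\}$ in the summand of $q$, by $$\partial b(p;S)=\sum_{q\in S}(-1)^{\sigma(q;S)}\Big(Y_{S_q}\,b(p;S\setminus\{q\})-X_{p\setminus q}\,b(q;q\wedge t_1,\dots,q\wedge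 t_k)\Big).$$ (b) If $\prec$ is compatible with meets, that is, $r\prec s$ implies $q\wedge r\prec q\wedge s$ for all $p\in\mathcal L_G$ and $q,r,s\in N(p)$ with $q\ne r$, $q\neq s$, then this formula reads $$\partial b(p;S)=\sum_{q\in S}(-1)^{\sigma(q;S)}\Big(Y_{S_q}\,b(p;S\setminus\{q\})-X_{p\setminus q}\,b(q;q\wedge(S\setminus\{q\}))\Big).$$ (c) A total order $\prec$ that extends the rank order and is compatible with meets exists. -/

import Mathlib

open MvPolynomial

noncomputable section

namespace UnmixedBipartite

/-! ### Graphs and the lattice of minimal vertex covers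

The vertices are `x_i = Sum.inl i` and `y_i = Sum.inr i` for `i : Fin n`. -/

/-- `G` is an unmixed bipartite graph on `{x_1, …, x_n} ∪ {y_1, …, y_n}`, labelled so that every
`{x_i, y_i}` is an edge (in particular, there are no isolated vertices). -/
structure IsUnmixedBipartite {n : ℕ} (G : SimpleGraph (Fin n ⊕ Fin n)) : Prop where
  bipartite : G ≤ completeBipartiteGraph (Fin n) (Fin n)
  unmixed : ∀ C D : Set (Fin n ⊕ Fin n), Minimal G.IsVertexCover C → Minimal G.IsVertexCover D →
    C.ncard = D.ncard
  matching : ∀ i : Fin n, G.Adj (Sum.inl i) (Sum.inr i)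

/-- The lattice `L_G` of the sets `C ∩ {x_1, …, x_n}`, `C` a minimal vertex cover of `G`. It is
ordered by inclusion, and its meet is intersection. -/
def coverLattice {n : ℕ} (G : SimpleGraph (Fin n ⊕ Fin n)) : Set (Finset (Fin n)) :=
  {p | ∃ C : Set (Fin n ⊕ Fin n), Minimal G.IsVertexCover C ∧ ∀ i, i ∈ p ↔ Sum.inl i ∈ C}

/-- `N(p)`: the elements of `L` covered by `p` in `L`. -/
def lowerNeighbors {n : ℕ} (L : Set (Finset (Fin n))) (p : Finset (Fin n)) :
    Set (Finset (Fin n)) :=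
  {q | q ∈ L ∧ q ⊂ p ∧ ∀ r ∈ L, q ⊂ r → ¬ r ⊂ p}

/-- `prec` is a strict total order on `L` which extends the rank order, the rank of `p` being the
maximal length of a chain in `L` descending from `p`. -/
structure IsRankOrder {n : ℕ} (L : Set (Finset (Fin n)))
    (prec : Finset (Fin n) → Finset (Fin n) → Prop) : Prop where
  irrefl : ∀ p ∈ L, ¬ prec p p
  trans : ∀ p ∈ L, ∀ q ∈ L, ∀ r ∈ L, prec p q → prec q r → prec p r
  total : ∀ p ∈ L, ∀ q ∈ L, p ≠ q → prec p q ∨ prec q p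
  rank : ∀ p q : L, Order.height p < Order.height q → prec p q

/-- For distinct `q, r, s ∈ N(p)`, `r ≺ s` implies `q ∧ r ≺ q ∧ s`. -/
def IsMeetCompatible {n : ℕ} (L : Set (Finset (Fin n)))
    (prec : Finset (Fin n) → Finset (Fin n) → Prop) : Prop :=
  ∀ p ∈ L, ∀ q ∈ lowerNeighbors L p, ∀ r ∈ lowerNeighbors L p, ∀ s ∈ lowerNeighbors L p,
    q ≠ r → q ≠ s → prec r s → prec (q ∩ r) (q ∩ s)

open Classical in
/-- `σ(q;S) = |{r ∈ S : r ≺ q}|`. -/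
def sigma {n : ℕ} (prec : Finset (Fin n) → Finset (Fin n) → Prop) (q : Finset (Fin n))
    (S : Finset (Finset (Fin n))) : ℕ :=
  (S.filter fun r => prec r q).card

/-- The family `q ∧ T = {q ∧ r : r ∈ T}`. -/
def meetFamily {n : ℕ} (q : Finset (Fin n)) (T : Finset (Finset (Fin n))) :
    Finset (Finset (Fin n)) :=
  T.image fun r => q ∩ r

/-! ### Monomials and the ideal -/

variable (K : Type*) [Field K]

/-- `X_A = ∏_{i ∈ A} x_i`. -/
def monX {n : ℕ} (A : Finset (Fin n)) : MvPolynomial (Fin n ⊕ Fin n) K := ∏ i ∈ A, X (Sum.inl i)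

/-- `Y_A = ∏_{i ∈ A} y_i`. -/
def monY {n : ℕ} (A : Finset (Fin n)) : MvPolynomial (Fin n ⊕ Fin n) K := ∏ i ∈ A, X (Sum.inr i)

/-- `u_p = X_p Y_{[n] ∖ p}`. -/
def u {n : ℕ} (p : Finset (Fin n)) : MvPolynomial (Fin n ⊕ Fin n) K := monX K p * monY K pᶜ

/-- The monomial ideal `H_L` generated by the `u_p`, `p ∈ L`. -/
def hibiIdeal {n : ℕ} (L : Set (Finset (Fin n))) : Ideal (MvPolynomial (Fin n ⊕ Fin n) K) :=
  Ideal.span (u K '' L)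

/-- `Y_{S_q}`, where `S_q = (⋀_{r ∈ S ∖ {q}} r) ∖ q`; meets are taken below `p`, so that the empty
meet is `p`. -/
def monYS {n : ℕ} (p q : Finset (Fin n)) (S : Finset (Finset (Fin n))) :
    MvPolynomial (Fin n ⊕ Fin n) K :=
  monY K ((p ⊓ (S.erase q).inf id) \ q)

/-! ### Multigraded free resolutions -/

/-- `⋯ → F_1 → F_0 → I → 0` is a minimal multigraded free resolution of the ideal `I` of the
polynomial ring `R`. Here `F_i` is the free `R`-module with basis `ι i`, whose elements
have the multidegrees `deg i`. -/
structure IsMinimalMultigradedFreeResolution {K : Type*} [Field K] {τ : Type*}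
    (I : Ideal (MvPolynomial τ K)) (ι : ℕ → Type*) (deg : ∀ i, ι i → (τ →₀ ℕ))
    (d : ∀ i, (ι (i + 1) →₀ MvPolynomial τ K) →ₗ[MvPolynomial τ K] (ι i →₀ MvPolynomial τ K))
    (aug : (ι 0 →₀ MvPolynomial τ K) →ₗ[MvPolynomial τ K] MvPolynomial τ K) : Prop where
  range_aug : LinearMap.range aug = I
  exact_zero : Function.Exact (d 0) aug
  exact_succ : ∀ i, Function.Exact (d (i + 1)) (d i)
  /-- the augmentation preserves multidegrees -/
  multigraded_aug : ∀ b, ∀ m ∈ (aug (Finsupp.single b 1)).support, m = deg 0 b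
  /-- the differential preserves multidegrees -/
  multigraded : ∀ i b c, ∀ m ∈ (d i (Finsupp.single b 1) c).support,
    m + deg i c = deg (i + 1) b
  /-- the image of every differential lies in `𝔪 F_i`, `𝔪` the ideal of the variables -/
  minimal : ∀ i, LinearMap.range (d i) ≤
    Ideal.span (Set.range (X : τ → MvPolynomial τ K)) • ⊤

/-! ### The free modules with basis `b(p;S)` -/

/-- `(p, S)` indexes a basis element in homological degree `i`: `p ∈ L`, `S ⊆ N(p)`, `|S| = i`. -/
def IsIndex {n : ℕ} (L : Set (Finset (Fin n))) (i : ℕ) (p : Finset (Fin n))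
    (S : Finset (Finset (Fin n))) : Prop :=
  p ∈ L ∧ (∀ q ∈ S, q ∈ lowerNeighbors L p) ∧ S.card = i

/-- The set of basis elements of `F_i`. -/
def Index {n : ℕ} (L : Set (Finset (Fin n))) (i : ℕ) : Type :=
  {b : Finset (Fin n) × Finset (Finset (Fin n)) // IsIndex L i b.1 b.2}

/-- The exponent vector of `u_p`. -/
def uExp {n : ℕ} (p : Finset (Fin n)) : Fin n ⊕ Fin n →₀ ℕ :=
  Finsupp.equivFunOnFinite.symm
    (Sum.elim (fun i => if i ∈ p then 1 else 0) (fun i => if i ∈ p then 0 else 1))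

/-- The multidegree of `b(p;S)`: the exponent vector of the least common multiple of `u_p` and all
`u_q`, `q ∈ S`. -/
def multideg {n : ℕ} (L : Set (Finset (Fin n))) (i : ℕ) (b : Index L i) : Fin n ⊕ Fin n →₀ ℕ :=
  uExp b.1.1 ⊔ b.1.2.sup uExp

/-- `F_i`. -/
abbrev FreeMod {n : ℕ} (L : Set (Finset (Fin n))) (i : ℕ) : Type _ :=
  Index L i →₀ MvPolynomial (Fin n ⊕ Fin n) K

open Classical in
/-- The basis element `b(p;S)` of `F_i` (a meaningless `0` if `(p, S)` is not an index in
degree `i`). -/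
def basisElt {n : ℕ} (L : Set (Finset (Fin n))) (i : ℕ) (p : Finset (Fin n))
    (S : Finset (Finset (Fin n))) : FreeMod K L i :=
  if h : IsIndex L i p S then Finsupp.single (⟨(p, S), h⟩ : Index L i) 1 else 0

open Classical in
/-- The number of inversions of the map `r ↦ q ∧ r` on `T`: pairs `r ≺ s` in `T` such that
`q ∧ s ≺ q ∧ r`. -/
def inversions {n : ℕ} (prec : Finset (Fin n) → Finset (Fin n) → Prop) (q : Finset (Fin n))
    (T : Finset (Finset (Fin n))) : ℕ :=
  ((T ×ˢ T).filter fun rs => prec rs.1 rs.2 ∧ prec (q ∩ rs.2) (q ∩ rs.1)).card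

/-- The oriented basis element `b(q; q ∧ t_1, …, q ∧ t_k)`, corresponding to
`e_{q ∧ t_1} ∧ ⋯ ∧ e_{q ∧ t_k}`, where `T = {t_1 ≺ ⋯ ≺ t_k}`. It is `b(q; q ∧ T)` up to the sign of
the permutation which sorts `q ∧ t_1, …, q ∧ t_k`. -/
def orientedMeetElt {n : ℕ} (L : Set (Finset (Fin n)))
    (prec : Finset (Fin n) → Finset (Fin n) → Prop) (i : ℕ) (q : Finset (Fin n))
    (T : Finset (Finset (Fin n))) : FreeMod K L i :=
  (-1 : MvPolynomial (Fin n ⊕ Fin n) K) ^ inversions prec q T • basisElt K L i q (meetFamily q T)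

end UnmixedBipartite

end

open MvPolynomial

noncomputable section

namespace UnmixedBipartite

/-! Unmixedness forces every minimal vertex cover to contain exactly one of x_i, y_i for each i.
Hence L_G consists of the subsets of [n] closed under a relation read off from the edges
(`mem_coverLattice_iff`), and it is stable under unions and intersections. Only this stability is
used afterwards. It makes the sets p ∖ q, q ∈ N(p), pairwise disjoint, so that S_q = p ∖ q, and it
makes r ↦ q ∩ r an injection of N(p) ∖ {q} into N(q) with q ∖ (q ∩ r) = p ∖ r (`inter_mem`,
`injOn_inter`, `sdiff_eq`).

∂² = 0: deleting q and then r from S produces four terms, indexed by p, r, q and q ∩ r. Their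
monomials and orientations are symmetric in q and r, while the sign is antisymmetric (`sigma_swap`).
The orientations match because sorting signs behave well under deletion of an element
(`inversions_insert`) and under iterated meets (`inversions_mul`).

Exactness: the Y-part of ∂ at a fixed p is the Koszul differential on the pairwise coprime monomials
Y_{p∖q}, a regular sequence, and the X-part moves strictly down in L. So a cycle can be cleared one
maximal element p of its support at a time (`mem_range_differential`). Dividing by each Y_{p∖q} in
turn and subtracting the boundary of the quotient leaves coefficients reduced modulo all Y_{p∖q};
the cycle condition then kills those at S ≠ ∅. In degree 0 the remainder at S = ∅ vanishes because
the colon ideal of the remaining u_r by u_p is generated by the Y_{p∖q}.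

With a compatible order no inversions occur. Such an order is given by rank, with ties broken
colexicographically. -/

/-- `L` is closed under intersections and unions. -/
structure IsSetLattice {n : ℕ} (L : Set (Finset (Fin n))) : Prop where
  inter : ∀ p ∈ L, ∀ q ∈ L, p ∩ q ∈ L
  union : ∀ p ∈ L, ∀ q ∈ L, p ∪ q ∈ L

/-! ### Minimal vertex covers and closed subsets of [n] -/

theorem IsUnmixedBipartite.minimal_range_inl {n : ℕ} {G : SimpleGraph (Fin n ⊕ Fin n)}
    (hG : IsUnmixedBipartite G) : Minimal G.IsVertexCover (Set.range Sum.inl) := by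
  refine ⟨?_, ?_⟩
  · intro v w h
    have := hG.bipartite h
    rcases v with v | v <;> rcases w with w | w <;> simp_all
  · intro D hD hle v hv
    obtain ⟨i, rfl⟩ := hv
    rcases hD (hG.matching i) with h | h
    · exact h
    · have := hle h
      simp at this

/-- A minimal cover C has as many elements as {x_1, …, x_n} and meets every matching edge, so it
contains only one end of each. Thus x_j ∈ C excludes y_j, and an edge {x_i, y_j} then needs x_i.
Conversely, a closed p gives the cover {x_i : i ∈ p} ∪ {y_i : i ∉ p}, which is minimal because of
the matching edges. -/
theorem IsUnmixedBipartite.mem_coverLattice_iff {n : ℕ} {G : SimpleGraph (Fin n ⊕ Fin n)}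
    (hG : IsUnmixedBipartite G) (p : Finset (Fin n)) :
    p ∈ coverLattice G ↔ ∀ i j, G.Adj (Sum.inl i) (Sum.inr j) → j ∈ p → i ∈ p := by
  constructor
  · rintro ⟨C, hC, hp⟩ i j hij hj
    have hcard := hG.unmixed _ _ hC hG.minimal_range_inl
    have himg : (Sum.elim id id : Fin n ⊕ Fin n → Fin n) '' C = Set.univ := by
      refine Set.eq_univ_of_forall fun k => ?_
      rcases hC.1 (hG.matching k) with h | h
      · exact ⟨_, h, rfl⟩
      · exact ⟨_, h, rfl⟩
    have hinj : Set.InjOn (Sum.elim id id : Fin n ⊕ Fin n → Fin n) C := by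
      refine Set.injOn_of_ncard_image_eq ?_ (Set.toFinite C)
      rw [himg, hcard, Set.ncard_univ, ← Set.image_univ,
        Set.ncard_image_of_injective _ Sum.inl_injective, Set.ncard_univ]
    rw [hp] at hj ⊢
    rcases hC.1 hij with h | h
    · exact h
    · have := hinj hj h rfl
      simp at this
  · intro h
    refine ⟨{v | Sum.elim (fun i => i ∈ p) (fun i => i ∉ p) v}, ⟨?_, ?_⟩, fun i => Iff.rfl⟩
    · intro v w hvw
      have hb := hG.bipartite hvw
      rcases v with v | v <;> rcases w with w | w <;> simp at hb
      · by_cases hw : w ∈ p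
        · exact Or.inl (h v w hvw hw)
        · exact Or.inr hw
      · by_cases hv : v ∈ p
        · exact Or.inr (h w v hvw.symm hv)
        · exact Or.inl hv
    · intro D hD hle v hv
      rcases v with i | i
      · rcases hD (hG.matching i) with h1 | h1
        · exact h1
        · exact absurd hv (hle h1)
      · rcases hD (hG.matching i) with h1 | h1
        · exact absurd (hle h1) hv
        · exact h1

theorem IsUnmixedBipartite.isSetLattice {n : ℕ} {G : SimpleGraph (Fin n ⊕ Fin n)}
    (hG : IsUnmixedBipartite G) : IsSetLattice (coverLattice G) := by
  constructor
  · intro p hp q hq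
    rw [hG.mem_coverLattice_iff] at *
    intro i j hij hj
    rw [Finset.mem_inter] at *
    exact ⟨hp i j hij hj.1, hq i j hij hj.2⟩
  · intro p hp q hq
    rw [hG.mem_coverLattice_iff] at *
    intro i j hij hj
    rw [Finset.mem_union] at *
    exact hj.imp (hp i j hij) (hq i j hij)

/-! ### Lower neighbours in a lattice of sets -/

section Neighbors

variable {n : ℕ} {L : Set (Finset (Fin n))} {p q r s : Finset (Fin n)}

theorem IsSetLattice.union_eq (hL : IsSetLattice L) (hq : q ∈ lowerNeighbors L p)
    (hr : r ∈ lowerNeighbors L p) (hne : q ≠ r) : q ∪ r = p := by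
  have h1 : q ∪ r ⊆ p := Finset.union_subset hq.2.1.1 hr.2.1.1
  have h2 : q ⊂ q ∪ r := by
    refine Finset.subset_union_left.ssubset_of_ne fun h => ?_
    have h3 : r ⊆ q := by rw [h]; exact Finset.subset_union_right
    exact hr.2.2 q hq.1 (h3.ssubset_of_ne hne.symm) hq.2.1
  by_contra h
  exact hq.2.2 _ (hL.union _ hq.1 _ hr.1) h2 (h1.ssubset_of_ne h)

theorem IsSetLattice.sdiff_subset (hL : IsSetLattice L) (hq : q ∈ lowerNeighbors L p)
    (hr : r ∈ lowerNeighbors L p) (hne : q ≠ r) : p \ r ⊆ q := by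
  rw [← hL.union_eq hq hr hne]
  intro i
  simp only [Finset.mem_sdiff, Finset.mem_union]
  tauto

theorem IsSetLattice.sdiff_eq (hL : IsSetLattice L) (hq : q ∈ lowerNeighbors L p)
    (hr : r ∈ lowerNeighbors L p) (hne : q ≠ r) : q \ (q ∩ r) = p \ r := by
  rw [← hL.union_eq hq hr hne]
  ext i
  simp only [Finset.mem_sdiff, Finset.mem_union, Finset.mem_inter]
  tauto

/-- This makes the monomials Y_{p∖q}, q ∈ N(p), pairwise coprime, which is the source of exactness.
-/
theorem IsSetLattice.disjoint_sdiff (hL : IsSetLattice L) (hq : q ∈ lowerNeighbors L p)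
    (hr : r ∈ lowerNeighbors L p) (hne : q ≠ r) : Disjoint (p \ q) (p \ r) :=
  Finset.disjoint_sdiff.symm.mono_right (hL.sdiff_subset hq hr hne)

theorem sdiff_nonempty_of_mem (hq : q ∈ lowerNeighbors L p) : (p \ q).Nonempty :=
  Finset.sdiff_nonempty.2 hq.2.1.2

/-- Modularity: an element t strictly between q ∩ r and q is not contained in r, so t ∪ r lies
strictly above r and must equal p. This forces q ⊆ t. -/
theorem IsSetLattice.inter_mem (hL : IsSetLattice L) (hq : q ∈ lowerNeighbors L p)
    (hr : r ∈ lowerNeighbors L p) (hne : q ≠ r) : q ∩ r ∈ lowerNeighbors L q := by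
  have hu := hL.union_eq hq hr hne
  refine ⟨hL.inter _ hq.1 _ hr.1, ?_, ?_⟩
  · refine Finset.inter_subset_left.ssubset_of_ne fun h => ?_
    have h3 : q ⊆ r := Finset.inter_eq_left.1 h
    exact hq.2.2 r hr.1 (h3.ssubset_of_ne hne) hr.2.1
  · intro t ht h1 h2
    have h3 : t ∪ r ⊆ p := Finset.union_subset (h2.1.trans hq.2.1.1) hr.2.1.1
    by_cases h4 : t ⊆ r
    · exact h1.2 (Finset.subset_inter h2.1 h4)
    · have h5 : r ⊂ t ∪ r := Finset.subset_union_right.ssubset_of_ne fun h => h4 (by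
        rw [h]; exact Finset.subset_union_left)
      have h6 : t ∪ r = p := by
        by_contra h
        exact hr.2.2 _ (hL.union _ ht _ hr.1) h5 (h3.ssubset_of_ne h)
      apply h2.2
      intro i hi
      have : i ∈ t ∪ r := by rw [h6]; exact hq.2.1.1 hi
      rcases Finset.mem_union.1 this with h | h
      · exact h
      · exact h1.1 (Finset.mem_inter.2 ⟨hi, h⟩)

/-- The set r is recovered from q ∩ r, since q ∖ (q ∩ r) = p ∖ r. -/
theorem IsSetLattice.injOn_inter (hL : IsSetLattice L) (hq : q ∈ lowerNeighbors L p)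
    (hr : r ∈ lowerNeighbors L p) (hs : s ∈ lowerNeighbors L p) (hqr : q ≠ r) (hqs : q ≠ s)
    (h : q ∩ r = q ∩ s) : r = s := by
  have h1 := hL.sdiff_eq hq hr hqr
  rw [h, hL.sdiff_eq hq hs hqs] at h1
  rw [← Finset.sdiff_sdiff_eq_self hr.2.1.1, ← h1, Finset.sdiff_sdiff_eq_self hs.2.1.1]

theorem exists_lowerNeighbor (hr : r ∈ L) (h : r ⊂ p) : ∃ q ∈ lowerNeighbors L p, r ⊆ q := by
  obtain ⟨q, hq, hmax⟩ := (Set.toFinite {q | q ∈ L ∧ r ⊆ q ∧ q ⊂ p}).exists_maximalFor id _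
    ⟨r, hr, subset_rfl, h⟩
  refine ⟨q, ⟨hq.1, hq.2.2, fun t ht h1 h2 => h1.2 ?_⟩, hq.2.1⟩
  exact hmax ⟨ht, hq.2.1.trans h1.1, h2⟩ h1.1

variable {i : ℕ} {S : Finset (Finset (Fin n))}

theorem IsSetLattice.injOn_of_isIndex (hL : IsSetLattice L) (h : IsIndex L i p S) (hq : q ∈ S) :
    Set.InjOn (fun r => q ∩ r) (S.erase q : Finset (Finset (Fin n))) := by
  intro r hr s hs hrs
  simp only [Finset.mem_coe, Finset.mem_erase] at hr hs
  exact hL.injOn_inter (h.2.1 q hq) (h.2.1 r hr.2) (h.2.1 s hs.2) hr.1.symm hs.1.symm hrs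

theorem IsIndex.erase (h : IsIndex L (i + 1) p S) (hq : q ∈ S) : IsIndex L i p (S.erase q) :=
  ⟨h.1, fun r hr => h.2.1 r (Finset.mem_of_mem_erase hr), by
    rw [Finset.card_erase_of_mem hq, h.2.2]; rfl⟩

theorem IsIndex.meetFamily (hL : IsSetLattice L) (h : IsIndex L (i + 1) p S) (hq : q ∈ S) :
    IsIndex L i q (meetFamily q (S.erase q)) := by
  refine ⟨(h.2.1 q hq).1, ?_, ?_⟩
  · intro t ht
    obtain ⟨r, hr, rfl⟩ := Finset.mem_image.1 ht
    rw [Finset.mem_erase] at hr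
    exact hL.inter_mem (h.2.1 q hq) (h.2.1 r hr.2) hr.1.symm
  · rw [UnmixedBipartite.meetFamily, Finset.card_image_of_injOn (hL.injOn_of_isIndex h hq),
      (h.erase hq).2.2]

/-- `S_q = p ∖ q`. -/
theorem IsSetLattice.inf_sdiff (hL : IsSetLattice L) (h : IsIndex L i p S) (hq : q ∈ S) :
    (p ⊓ (S.erase q).inf id) \ q = p \ q := by
  refine Finset.Subset.antisymm (Finset.sdiff_subset_sdiff inf_le_left subset_rfl) ?_
  intro k hk
  have hk' := Finset.mem_sdiff.1 hk
  refine Finset.mem_sdiff.2 ⟨?_, hk'.2⟩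
  have h1 : p \ q ≤ (S.erase q).inf id := Finset.le_inf fun r hr => by
    rw [Finset.mem_erase] at hr
    exact hL.sdiff_subset (h.2.1 r hr.2) (h.2.1 q hq) hr.1
  exact Finset.mem_inter.2 ⟨hk'.1, h1 hk⟩

end Neighbors

/-! ### The rank function and a compatible order -/

section RankOrder

variable {n : ℕ} {L : Set (Finset (Fin n))}

/-- Two distinct lower neighbours of p both cover their intersection, so by induction on the bound k
for the cardinality they have the same height. -/
theorem IsSetLattice.height_eq (hL : IsSetLattice L) (k : ℕ) : ∀ p q : L, p.1.card ≤ k →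
    q.1 ∈ lowerNeighbors L p.1 → Order.height p = Order.height q + 1 := by
  induction k with
  | zero =>
    intro p q hp hq
    have := Finset.card_lt_card hq.2.1
    omega
  | succ k ih =>
    have key : ∀ p q r : L, p.1.card ≤ k + 1 → q.1 ∈ lowerNeighbors L p.1 →
        r.1 ∈ lowerNeighbors L p.1 → Order.height r = Order.height q := by
      intro p q r hp hq hr
      by_cases hne : q = r
      · rw [hne]
      have hne' : q.1 ≠ r.1 := fun h => hne (Subtype.ext h)
      have h1 := hL.inter_mem hq hr hne'
      have h2 := hL.inter_mem hr hq hne'.symm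
      rw [Finset.inter_comm] at h2
      have hcq := Finset.card_lt_card hq.2.1
      have hcr := Finset.card_lt_card hr.2.1
      rw [ih q ⟨q.1 ∩ r.1, h1.1⟩ (by omega) h1, ih r ⟨q.1 ∩ r.1, h1.1⟩ (by omega) h2]
    intro p q hp hq
    apply le_antisymm
    -- Every r < p lies below some lower neighbour of p, and all of these have the height of q.
    · rw [Order.height_eq_iSup_lt_height]
      refine iSup₂_le fun r hr => ?_
      obtain ⟨s, hs, hrs⟩ := exists_lowerNeighbor r.2 (show r.1 ⊂ p.1 from hr)
      rw [← key p q ⟨s, hs.1⟩ hp hq hs]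
      exact add_le_add_left (Order.height_mono (show r ≤ ⟨s, hs.1⟩ from hrs)) 1
    · exact Order.height_add_one_le (show q < p from hq.2.1)

/-- The order by rank, where ties are broken by the colexicographic order. -/
def rankColex (L : Set (Finset (Fin n))) (p q : Finset (Fin n)) : Prop :=
  ∃ (hp : p ∈ L) (hq : q ∈ L), Order.height (⟨p, hp⟩ : L) < Order.height (⟨q, hq⟩ : L) ∨
    Order.height (⟨p, hp⟩ : L) = Order.height (⟨q, hq⟩ : L) ∧ toColex p < toColex q

theorem isRankOrder_rankColex (L : Set (Finset (Fin n))) : IsRankOrder L (rankColex L) where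
  irrefl := by
    rintro p hp ⟨_, _, h | h⟩
    · exact lt_irrefl _ h
    · exact lt_irrefl _ h.2
  trans := by
    rintro p hp q hq r hr ⟨_, _, h⟩ ⟨_, _, h'⟩
    refine ⟨hp, hr, ?_⟩
    rcases h with h | h <;> rcases h' with h' | h'
    · exact Or.inl (h.trans h')
    · exact Or.inl (h'.1 ▸ h)
    · exact Or.inl (h.1 ▸ h')
    · exact Or.inr ⟨h.1.trans h'.1, h.2.trans h'.2⟩
  total := by
    intro p hp q hq hne
    rcases lt_trichotomy (Order.height (⟨p, hp⟩ : L)) (Order.height (⟨q, hq⟩ : L)) with h | h | h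
    · exact Or.inl ⟨hp, hq, Or.inl h⟩
    · rcases lt_or_gt_of_ne (fun h => hne (toColex_inj.1 h) : toColex p ≠ toColex q) with h' | h'
      · exact Or.inl ⟨hp, hq, Or.inr ⟨h, h'⟩⟩
      · exact Or.inr ⟨hq, hp, Or.inr ⟨h.symm, h'⟩⟩
    · exact Or.inr ⟨hq, hp, Or.inl h⟩
  rank := fun p q h => ⟨p.2, q.2, Or.inl h⟩

/-- Distinct lower neighbours of p have equal rank, and so do their meets with q; hence only the
colexicographic comparison matters. It depends only on the two set differences, and these do not
change under intersection with q, because p ∖ r and p ∖ s lie in q. -/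
theorem IsSetLattice.isMeetCompatible_rankColex (hL : IsSetLattice L) :
    IsMeetCompatible L (rankColex L) := by
  rintro p hp q hq r hr s hs hqr hqs ⟨hr', hs', h⟩
  have hr1 := hL.height_eq _ ⟨p, hp⟩ ⟨r, hr'⟩ le_rfl hr
  have hs1 := hL.height_eq _ ⟨p, hp⟩ ⟨s, hs'⟩ le_rfl hs
  have hqr1 := hL.inter_mem hq hr hqr
  have hqs1 := hL.inter_mem hq hs hqs
  have hr2 := hL.height_eq _ ⟨q, hq.1⟩ ⟨q ∩ r, hqr1.1⟩ le_rfl hqr1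
  have hs2 := hL.height_eq _ ⟨q, hq.1⟩ ⟨q ∩ s, hqs1.1⟩ le_rfl hqs1
  have hrs : Order.height (⟨r, hr'⟩ : L) = Order.height (⟨s, hs'⟩ : L) := by
    rw [hr1] at hs1
    exact ENat.add_left_injective_of_ne_top ENat.one_ne_top hs1
  have hlt : toColex r < toColex s := by
    rcases h with h | h
    · exact absurd hrs h.ne
    · exact h.2
  have hrs' : r ≠ s := fun h => by simp [h] at hlt
  refine ⟨hqr1.1, hqs1.1, Or.inr ⟨?_, ?_⟩⟩
  · rw [hr2] at hs2
    exact ENat.add_left_injective_of_ne_top ENat.one_ne_top hs2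
  · have hs3 := hL.sdiff_subset hq hs hqs
    have hr3 := hL.sdiff_subset hq hr hqr
    have e1 : (q ∩ r) \ (q ∩ s) = r \ s := by
      ext i
      have h1 := @hs3 i
      have h2 := @hr.2.1.1 i
      simp only [Finset.mem_sdiff, Finset.mem_inter] at *
      tauto
    have e2 : (q ∩ s) \ (q ∩ r) = s \ r := by
      ext i
      have h1 := @hr3 i
      have h2 := @hs.2.1.1 i
      simp only [Finset.mem_sdiff, Finset.mem_inter] at *
      tauto
    rw [← Finset.Colex.toColex_sdiff_lt_toColex_sdiff', e1, e2]
    exact Finset.Colex.toColex_sdiff_lt_toColex_sdiff'.2 hlt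

end RankOrder

/-! ### Signs of orderings -/

section Signs

variable {n : ℕ} {L : Set (Finset (Fin n))} {prec : Finset (Fin n) → Finset (Fin n) → Prop}

theorem IsRankOrder.asymm (h : IsRankOrder L prec) {p q : Finset (Fin n)} (hp : p ∈ L)
    (hq : q ∈ L) (hpq : prec p q) : ¬ prec q p := fun hqp =>
  h.irrefl p hp (h.trans p hp q hq p hp hpq hqp)

variable (A : Type*) [CommRing A]

theorem neg_one_pow_card_filter {ι : Type*} (s : Finset ι) (P : ι → Prop) [DecidablePred P] :
    (-1 : A) ^ (s.filter P).card = ∏ x ∈ s, if P x then -1 else 1 := by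
  rw [Finset.prod_ite]; simp

open Classical in
theorem neg_one_pow_sigma (q : Finset (Fin n)) (S : Finset (Finset (Fin n))) :
    (-1 : A) ^ sigma prec q S = ∏ r ∈ S, if prec r q then -1 else 1 :=
  neg_one_pow_card_filter A S _

open Classical in
theorem neg_one_pow_inversions (q : Finset (Fin n)) (T : Finset (Finset (Fin n))) :
    (-1 : A) ^ inversions prec q T =
      ∏ a ∈ T, ∏ b ∈ T, if prec a b ∧ prec (q ∩ b) (q ∩ a) then -1 else 1 := by
  rw [← Finset.prod_product', inversions, neg_one_pow_card_filter]

theorem sq_neg_one_pow (k : ℕ) : (-1 : A) ^ k * (-1) ^ k = 1 := by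
  rw [← mul_pow]; simp

open Classical in
/-- Swapping two elements changes the sign in the square of the simplicial differential. -/
theorem IsRankOrder.sigma_swap (h : IsRankOrder L prec) {S : Finset (Finset (Fin n))}
    {q r : Finset (Fin n)} (hqL : q ∈ L) (hrL : r ∈ L) (hq : q ∈ S) (hr : r ∈ S) (hne : q ≠ r) :
    (-1 : A) ^ sigma prec q S * (-1) ^ sigma prec r (S.erase q) =
      -((-1) ^ sigma prec r S * (-1) ^ sigma prec q (S.erase r)) := by
  simp only [neg_one_pow_sigma]
  rw [← Finset.mul_prod_erase S (fun x => if prec x q then (-1 : A) else 1) hr,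
    ← Finset.mul_prod_erase S (fun x => if prec x r then (-1 : A) else 1) hq]
  rcases h.total q hqL r hrL hne with h1 | h1
  · rw [if_pos h1, if_neg (h.asymm hqL hrL h1)]; ring
  · rw [if_pos h1, if_neg (h.asymm hrL hqL h1)]; ring

open Classical in
-- An element t of T forms an inversion with r exactly when q ∩ · reverses their order, that is,
-- when exactly one of t ≺ r and q ∩ t ≺ q ∩ r holds. The product of the two comparison signs
-- records this.
theorem IsRankOrder.inversions_insert (h : IsRankOrder L prec) {T : Finset (Finset (Fin n))}
    {q r : Finset (Fin n)} (hr : r ∉ T) (hrL : r ∈ L) (hT : ∀ t ∈ T, t ∈ L)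
    (hqr : q ∩ r ∈ L) (hqT : ∀ t ∈ T, q ∩ t ∈ L)
    (hinj : Set.InjOn (fun t => q ∩ t) (insert r T : Finset (Finset (Fin n)))) :
    (-1 : A) ^ inversions prec q (insert r T) =
      (-1) ^ inversions prec q T *
        ((-1) ^ sigma prec r T * (-1) ^ sigma prec (q ∩ r) (meetFamily q T)) := by
  have hinj' : Set.InjOn (fun t => q ∩ t) (T : Set (Finset (Fin n))) :=
    hinj.mono (by simp)
  simp only [neg_one_pow_sigma, neg_one_pow_inversions, meetFamily]
  rw [Finset.prod_image hinj', Finset.prod_insert hr, Finset.prod_insert hr,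
    if_neg (fun h' => h.irrefl r hrL h'.1), one_mul]
  simp only [Finset.prod_insert hr, Finset.prod_mul_distrib]
  rw [← mul_assoc, mul_comm]
  simp only [← Finset.prod_mul_distrib]
  refine Finset.prod_congr rfl fun t ht => congrArg (_ * ·) ?_
  have hne : t ≠ r := fun h' => hr (h' ▸ ht)
  have hne' : q ∩ t ≠ q ∩ r := fun h' =>
    hne (hinj (Finset.mem_insert_of_mem ht) (Finset.mem_insert_self _ _) h')
  rcases h.total t (hT t ht) r hrL hne with h1 | h1 <;>
  rcases h.total _ (hqT t ht) _ hqr hne' with h2 | h2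
  · simp [h1, h2, h.asymm (hT t ht) hrL h1, h.asymm (hqT t ht) hqr h2]
  · simp [h1, h2, h.asymm (hT t ht) hrL h1, h.asymm hqr (hqT t ht) h2]
  · simp [h1, h2, h.asymm hrL (hT t ht) h1, h.asymm (hqT t ht) hqr h2]
  · simp [h1, h2, h.asymm hrL (hT t ht) h1, h.asymm hqr (hqT t ht) h2]

theorem inter_inter_of_subset {w q t : Finset (Fin n)} (hw : w ⊆ q) : w ∩ (q ∩ t) = w ∩ t := by
  rw [← Finset.inter_assoc, Finset.inter_eq_left.2 hw]

theorem meetFamily_meetFamily {w q : Finset (Fin n)} (hw : w ⊆ q) (T : Finset (Finset (Fin n))) :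
    meetFamily w (meetFamily q T) = meetFamily w T := by
  simp only [meetFamily, Finset.image_image]
  exact Finset.image_congr fun t _ => inter_inter_of_subset hw

/-- The signs of the permutations which sort `q ∧ T` and `w ∧ (q ∧ T)` multiply. -/
theorem IsRankOrder.inversions_mul (h : IsRankOrder L prec) (hLL : IsSetLattice L)
    {q w : Finset (Fin n)} (hq : q ∈ L) (hw : w ∈ L) (hwq : w ⊆ q) (T : Finset (Finset (Fin n))) :
    (∀ t ∈ T, t ∈ L) → Set.InjOn (fun t => w ∩ t) (T : Set (Finset (Fin n))) →
    (-1 : A) ^ inversions prec q T * (-1) ^ inversions prec w (meetFamily q T) =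
      (-1) ^ inversions prec w T := by
  induction T using Finset.induction_on with
  | empty => simp [inversions, meetFamily]
  | insert r T hr ih =>
    intro hT hinj
    have hrL := hT r (Finset.mem_insert_self _ _)
    have hTL : ∀ t ∈ T, t ∈ L := fun t ht => hT t (Finset.mem_insert_of_mem ht)
    have hinjq : Set.InjOn (fun t => q ∩ t) (insert r T : Finset (Finset (Fin n))) := by
      intro a ha b hb hab
      refine hinj ha hb ?_
      change w ∩ a = w ∩ b
      rw [← inter_inter_of_subset hwq, ← inter_inter_of_subset (t := b) hwq]
      exact congrArg (w ∩ ·) hab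
    have hmf : meetFamily q (insert r T) = insert (q ∩ r) (meetFamily q T) := by
      simp [meetFamily]
    have hqr : q ∩ r ∉ meetFamily q T := by
      intro hmem
      obtain ⟨t, ht, hqt⟩ := Finset.mem_image.1 hmem
      have := hinjq (Finset.mem_insert_of_mem ht) (Finset.mem_insert_self _ _) hqt
      exact hr (this ▸ ht)
    have hmL : ∀ t ∈ meetFamily q T, t ∈ L := by
      intro t ht
      obtain ⟨t', ht', rfl⟩ := Finset.mem_image.1 ht
      exact hLL.inter _ hq _ (hTL t' ht')
    have hinj2 : Set.InjOn (fun t => w ∩ t) (meetFamily q (insert r T) : Finset _) := by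
      intro a ha b hb hab
      obtain ⟨a', ha', rfl⟩ := Finset.mem_image.1 ha
      obtain ⟨b', hb', rfl⟩ := Finset.mem_image.1 hb
      simp only [inter_inter_of_subset hwq] at hab
      rw [hinj ha' hb' hab]
    rw [hmf] at hinj2 ⊢
    rw [h.inversions_insert A hr hrL hTL (hLL.inter _ hq _ hrL)
      (fun t ht => hLL.inter _ hq _ (hTL t ht)) hinjq,
      h.inversions_insert A hqr (hLL.inter _ hq _ hrL) hmL
      (hLL.inter _ hw _ (hLL.inter _ hq _ hrL)) (fun t ht => hLL.inter _ hw _ (hmL t ht)) hinj2,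
      h.inversions_insert A hr hrL hTL (hLL.inter _ hw _ hrL)
      (fun t ht => hLL.inter _ hw _ (hTL t ht)) hinj,
      ← ih hTL (hinj.mono (by simp)), meetFamily_meetFamily hwq, inter_inter_of_subset hwq]
    -- The comparison sign of q ∩ r with q ∧ T occurs in both factors on the left and squares to 1.
    linear_combination ((-1 : A) ^ inversions prec q T * (-1) ^ inversions prec w (meetFamily q T) *
      (-1) ^ sigma prec r T * (-1) ^ sigma prec (w ∩ r) (meetFamily w T)) *
        sq_neg_one_pow A (sigma prec (q ∩ r) (meetFamily q T))

theorem meetFamily_erase {q r : Finset (Fin n)} {T : Finset (Finset (Fin n))} (hr : r ∈ T)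
    (hinj : Set.InjOn (fun t => q ∩ t) (T : Set (Finset (Fin n)))) :
    (meetFamily q T).erase (q ∩ r) = meetFamily q (T.erase r) := by
  ext t
  simp only [meetFamily, Finset.mem_erase, Finset.mem_image]
  constructor
  · rintro ⟨hne, s, hs, rfl⟩
    exact ⟨s, ⟨fun h => hne (h ▸ rfl), hs⟩, rfl⟩
  · rintro ⟨s, ⟨hne, hs⟩, rfl⟩
    exact ⟨fun h => hne (hinj hs hr h), s, hs, rfl⟩

/-- The terms cancel in pairs under (a, b) ↔ (b, a), which has no fixed points. No division by 2 is
needed, so the characteristic is arbitrary. -/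
theorem sum_sum_erase_eq_zero {ι M : Type*} [DecidableEq ι] [AddCommGroup M] (S : Finset ι)
    (f : ι → ι → M) (hf : ∀ a ∈ S, ∀ b ∈ S, a ≠ b → f a b = -f b a) :
    ∑ a ∈ S, ∑ b ∈ S.erase a, f a b = 0 := by
  rw [Finset.sum_sigma']
  refine Finset.sum_involution (fun x _ => ⟨x.2, x.1⟩) ?_ ?_ ?_ ?_
  · rintro ⟨a, b⟩ hx
    simp only [Finset.mem_sigma, Finset.mem_erase] at hx
    simp [hf a hx.1 b hx.2.2 hx.2.1.symm]
  · rintro ⟨a, b⟩ hx _ h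
    simp only [Finset.mem_sigma, Finset.mem_erase] at hx
    simp only [Sigma.mk.injEq] at h
    exact hx.2.1 h.1
  · rintro ⟨a, b⟩ hx
    simp only [Finset.mem_sigma, Finset.mem_erase] at hx ⊢
    exact ⟨hx.2.2, hx.2.1.symm, hx.1⟩
  · rintro ⟨a, b⟩ _
    rfl

end Signs

/-! ### The differential and its square -/

section Differential

/-- The element `p` of the index `(p, S)`. -/
def Index.pt {n : ℕ} {L : Set (Finset (Fin n))} {i : ℕ} (b : Index L i) : Finset (Fin n) :=
  (show {b : Finset (Fin n) × Finset (Finset (Fin n)) // IsIndex L i b.1 b.2} from b).1.1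

/-- The set `S` of the index `(p, S)`. -/
def Index.nbrs {n : ℕ} {L : Set (Finset (Fin n))} {i : ℕ} (b : Index L i) :
    Finset (Finset (Fin n)) :=
  (show {b : Finset (Fin n) × Finset (Finset (Fin n)) // IsIndex L i b.1 b.2} from b).1.2

/-- The index `(p, S)`. -/
def Index.mk {n : ℕ} {L : Set (Finset (Fin n))} {i : ℕ} (p : Finset (Fin n))
    (S : Finset (Finset (Fin n))) (h : IsIndex L i p S) : Index L i :=
  (⟨(p, S), h⟩ : {b : Finset (Fin n) × Finset (Finset (Fin n)) // IsIndex L i b.1 b.2})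

theorem Index.isIndex {n : ℕ} {L : Set (Finset (Fin n))} {i : ℕ} (b : Index L i) :
    IsIndex L i b.pt b.nbrs :=
  (show {b : Finset (Fin n) × Finset (Finset (Fin n)) // IsIndex L i b.1 b.2} from b).2

theorem Index.ext {n : ℕ} {L : Set (Finset (Fin n))} {i : ℕ} {b c : Index L i}
    (h : b.pt = c.pt) (h' : b.nbrs = c.nbrs) : b = c :=
  Subtype.ext (Prod.ext h h')

theorem smul_sub_sub_add_comm {R M : Type*} [CommRing R] [AddCommGroup M] [Module R M]
    (x x' y y' e e' w : R) (A B C D : M) :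
    (y * y') • A - (y * x' * e') • B - (x * y' * e) • C + (x * x' * w) • D =
      (y' * y) • A - (y' * x * e) • C - (x' * y * e') • B + (x' * x * w) • D := by
  module

/-- The (q, r)-term of ∂². The primed and unprimed x, y belong to r and q. The hypothesis `h₁`
compares deleting r before and after taking meets with q; `h₂` composes the two orientations on the
way to q ∩ r. -/
theorem smul_boundary_pair {R M : Type*} [CommRing R] [AddCommGroup M] [Module R M]
    {s s' s'' x x' y y' e e₁ e' w w' : R} (A B C D : M) (h₁ : e₁ * s'' = e * s')
    (h₂ : e * w' = w) :
    s • (y • s' • (y' • A - (x' * e') • B) - (x * e₁) • s'' • (y' • C - (x' * w') • D)) =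
      (s * s') • ((y * y') • A - (y * x' * e') • B - (x * y' * e) • C + (x * x' * w) • D) := by
  subst h₂
  have h₃ : (x * e₁) • s'' • (y' • C - (x' * w') • D) =
      s' • ((x * y' * e) • C - (x * x' * (e * w')) • D) := by
    simp only [smul_sub, smul_smul]
    congr 2
    · linear_combination (x * y') * h₁
    · linear_combination (x * x' * w') * h₁
  rw [h₃]
  module

variable (K : Type*) [Field K] {n : ℕ} (L : Set (Finset (Fin n)))
  (prec : Finset (Fin n) → Finset (Fin n) → Prop)

/-- The boundary of `b(p;S)`. -/
def boundary (i : ℕ) (p : Finset (Fin n)) (S : Finset (Finset (Fin n))) : FreeMod K L i :=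
  ∑ q ∈ S, (-1 : MvPolynomial (Fin n ⊕ Fin n) K) ^ sigma prec q S •
    (monYS K p q S • basisElt K L i p (S.erase q) -
      monX K (p \ q) • orientedMeetElt K L prec i q (S.erase q))

/-- The differential `F_{i+1} → F_i`. -/
def differential (i : ℕ) :
    FreeMod K L (i + 1) →ₗ[MvPolynomial (Fin n ⊕ Fin n) K] FreeMod K L i :=
  Finsupp.linearCombination _ fun b : Index L (i + 1) => boundary K L prec i b.pt b.nbrs

/-- The augmentation `b(p;∅) ↦ u_p`. -/
def augmentation :
    FreeMod K L 0 →ₗ[MvPolynomial (Fin n ⊕ Fin n) K] MvPolynomial (Fin n ⊕ Fin n) K :=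
  Finsupp.linearCombination _ fun b : Index L 0 => u K b.pt

variable {L} {i : ℕ} {p : Finset (Fin n)} {S : Finset (Finset (Fin n))}

theorem basisElt_of_isIndex (h : IsIndex L i p S) :
    basisElt K L i p S = Finsupp.single (Index.mk p S h) 1 := dif_pos h

theorem differential_single (b : Index L (i + 1)) (c : MvPolynomial (Fin n ⊕ Fin n) K) :
    differential K L prec i (Finsupp.single b c) = c • boundary K L prec i b.pt b.nbrs :=
  Finsupp.linearCombination_single _ _ _

theorem augmentation_single (b : Index L 0) (c : MvPolynomial (Fin n ⊕ Fin n) K) :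
    augmentation K L (Finsupp.single b c) = c * u K b.pt :=
  Finsupp.linearCombination_single _ _ _

theorem differential_basisElt (h : IsIndex L (i + 1) p S) :
    differential K L prec i (basisElt K L (i + 1) p S) = boundary K L prec i p S := by
  rw [basisElt_of_isIndex K h, differential_single, one_smul]
  rfl

theorem augmentation_basisElt (h : p ∈ L) :
    augmentation K L (basisElt K L 0 p ∅) = u K p := by
  rw [basisElt_of_isIndex K ⟨h, by simp, by simp⟩, augmentation_single, one_mul]
  rfl

theorem IsSetLattice.boundary_eq (hL : IsSetLattice L) (h : IsIndex L (i + 1) p S) :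
    boundary K L prec i p S =
      ∑ q ∈ S, (-1 : MvPolynomial (Fin n ⊕ Fin n) K) ^ sigma prec q S •
        (monY K (p \ q) • basisElt K L i p (S.erase q) -
          (monX K (p \ q) * (-1) ^ inversions prec q (S.erase q)) •
            basisElt K L i q (meetFamily q (S.erase q))) := by
  refine Finset.sum_congr rfl fun q hq => ?_
  rw [monYS, hL.inf_sdiff h hq, orientedMeetElt, smul_smul]

variable {prec}

/-- The square expands over ordered pairs of distinct q, r ∈ S. Exchanging q and r swaps the two
mixed terms, fixes the other two and reverses the sign. -/
theorem IsSetLattice.differential_boundary (hL : IsSetLattice L) (hprec : IsRankOrder L prec)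
    (h : IsIndex L (i + 2) p S) :
    differential K L prec i (boundary K L prec (i + 1) p S) = 0 := by
  have hSL : ∀ r ∈ S, r ∈ L := fun r hr => (h.2.1 r hr).1
  let R := MvPolynomial (Fin n ⊕ Fin n) K
  let f : Finset (Fin n) → Finset (Fin n) → FreeMod K L i := fun q r =>
    ((-1 : R) ^ sigma prec q S * (-1) ^ sigma prec r (S.erase q)) •
      ((monY K (p \ q) * monY K (p \ r)) • basisElt K L i p ((S.erase q).erase r)
        - (monY K (p \ q) * monX K (p \ r) * (-1) ^ inversions prec r ((S.erase q).erase r)) •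
          basisElt K L i r (meetFamily r ((S.erase q).erase r))
        - (monX K (p \ q) * monY K (p \ r) * (-1) ^ inversions prec q ((S.erase q).erase r)) •
          basisElt K L i q (meetFamily q ((S.erase q).erase r))
        + (monX K (p \ q) * monX K (p \ r) *
            (-1) ^ inversions prec (q ∩ r) ((S.erase q).erase r)) •
          basisElt K L i (q ∩ r) (meetFamily (q ∩ r) ((S.erase q).erase r)))
  have hf : ∀ q ∈ S, ∀ r ∈ S, q ≠ r → f q r = -f r q := by
    intro q hq r hr hne
    simp only [f]
    rw [hprec.sigma_swap R (hSL q hq) (hSL r hr) hq hr hne, Finset.erase_right_comm (a := r),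
      Finset.inter_comm r q, neg_smul, smul_sub_sub_add_comm]
  rw [hL.boundary_eq K prec h, map_sum, ← sum_sum_erase_eq_zero S f hf]
  refine Finset.sum_congr rfl fun q hq => ?_
  have hinj := hL.injOn_of_isIndex h hq
  have hm := h.meetFamily hL hq
  rw [map_smul, map_sub, map_smul, map_smul, differential_basisElt K prec (h.erase hq),
    differential_basisElt K prec hm, hL.boundary_eq K prec (h.erase hq),
    hL.boundary_eq K prec hm]
  -- The boundary at q is a sum over q ∧ (S ∖ {q}); by injectivity it is reindexed over S ∖ {q}.
  conv_lhs => enter [2, 2, 2, 1]; rw [meetFamily]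
  rw [Finset.sum_image hinj, Finset.smul_sum, Finset.smul_sum, ← Finset.sum_sub_distrib,
    Finset.smul_sum]
  refine Finset.sum_congr rfl fun r hr => ?_
  have hr' := Finset.mem_erase.1 hr
  have hqN := h.2.1 q hq
  have hrN := h.2.1 r hr'.2
  have hqr : q ∩ r ∈ lowerNeighbors L q := hL.inter_mem hqN hrN hr'.1.symm
  have hTL : ∀ t ∈ (S.erase q).erase r, t ∈ L := fun t ht =>
    hSL t (Finset.mem_of_mem_erase (Finset.mem_of_mem_erase ht))
  have hinjT : Set.InjOn (fun t => q ∩ t) ((S.erase q).erase r : Finset _) :=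
    hinj.mono (Finset.coe_subset.2 (Finset.erase_subset _ _))
  rw [meetFamily_erase hr hinj, hL.sdiff_eq hqN hrN hr'.1.symm,
    meetFamily_meetFamily Finset.inter_subset_left]
  -- This is `inversions_insert` for r and S ∖ {q, r}. Including r itself in the sets over which σ
  -- counts changes nothing, by irreflexivity.
  have e1 : (-1 : R) ^ inversions prec q (S.erase q) *
      (-1) ^ sigma prec (q ∩ r) (meetFamily q (S.erase q)) =
      (-1) ^ inversions prec q ((S.erase q).erase r) * (-1) ^ sigma prec r (S.erase q) := by
    have hi := hprec.inversions_insert R (q := q) (Finset.notMem_erase r (S.erase q)) hrN.1 hTL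
      hqr.1 (fun t ht => hL.inter _ hqN.1 _ (hTL t ht)) (by rwa [Finset.insert_erase hr])
    rw [Finset.insert_erase hr] at hi
    have hs : (-1 : R) ^ sigma prec r (S.erase q) =
        (-1) ^ sigma prec r ((S.erase q).erase r) := by
      rw [neg_one_pow_sigma, ← Finset.mul_prod_erase _ _ hr, if_neg (hprec.irrefl r hrN.1),
        one_mul, ← neg_one_pow_sigma]
    have hs' : (-1 : R) ^ sigma prec (q ∩ r) (meetFamily q (S.erase q)) =
        (-1) ^ sigma prec (q ∩ r) (meetFamily q ((S.erase q).erase r)) := by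
      rw [neg_one_pow_sigma, ← Finset.mul_prod_erase (meetFamily q (S.erase q)) _ (Finset.mem_image_of_mem _ hr),
        if_neg (hprec.irrefl _ hqr.1), one_mul, ← neg_one_pow_sigma]
      rw [meetFamily_erase hr hinj]
    rw [hi, hs, hs', mul_assoc, mul_assoc, sq_neg_one_pow, mul_one]
  have hinjw : Set.InjOn (fun t => q ∩ r ∩ t) ((S.erase q).erase r : Finset _) := by
    have h2 := hL.injOn_of_isIndex hm (Finset.mem_image_of_mem _ hr : q ∩ r ∈ _)
    intro a ha b hb hab
    refine hinjT ha hb (h2 ?_ ?_ ?_)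
    · rw [meetFamily_erase hr hinj]; exact Finset.mem_image_of_mem _ ha
    · rw [meetFamily_erase hr hinj]; exact Finset.mem_image_of_mem _ hb
    · change q ∩ r ∩ (q ∩ a) = q ∩ r ∩ (q ∩ b)
      rw [inter_inter_of_subset Finset.inter_subset_left,
        inter_inter_of_subset Finset.inter_subset_left]
      exact hab
  have e2 := hprec.inversions_mul R hL hqN.1 hqr.1 Finset.inter_subset_left _ hTL hinjw
  exact smul_boundary_pair _ _ _ _ e1 e2

theorem IsSetLattice.differential_differential (hL : IsSetLattice L) (hprec : IsRankOrder L prec)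
    (z : FreeMod K L (i + 2)) :
    differential K L prec i (differential K L prec (i + 1) z) = 0 := by
  induction z using Finsupp.induction_linear with
  | zero => simp
  | add x y hx hy => rw [map_add, map_add, hx, hy, add_zero]
  | single b c =>
    rw [differential_single, map_smul, hL.differential_boundary K hprec b.isIndex, smul_zero]

theorem monX_mul {A B : Finset (Fin n)} (h : Disjoint A B) :
    monX K A * monX K B = monX K (A ∪ B) := (Finset.prod_union h).symm

theorem monY_mul {A B : Finset (Fin n)} (h : Disjoint A B) :
    monY K A * monY K B = monY K (A ∪ B) := (Finset.prod_union h).symm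

theorem monY_mul_u {q : Finset (Fin n)} (h : q ⊆ p) :
    monY K (p \ q) * u K p = monX K (p \ q) * u K q := by
  have h1 : monX K (p \ q) * monX K q = monX K p := by
    rw [monX_mul K Finset.sdiff_disjoint, Finset.sdiff_union_of_subset h]
  have h2 : monY K (p \ q) * monY K pᶜ = monY K qᶜ := by
    rw [monY_mul]
    · congr 1
      ext i
      have := @h i
      simp only [Finset.mem_union, Finset.mem_sdiff, Finset.mem_compl]
      tauto
    · exact disjoint_compl_right.mono_left Finset.sdiff_subset
  rw [u, u, ← h1, ← h2]
  ring

theorem IsSetLattice.augmentation_differential (hL : IsSetLattice L)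
    (z : FreeMod K L 1) : augmentation K L (differential K L prec 0 z) = 0 := by
  induction z using Finsupp.induction_linear with
  | zero => simp
  | add x y hx hy => rw [map_add, map_add, hx, hy, add_zero]
  | single b c =>
    rw [differential_single, map_smul, hL.boundary_eq K prec b.isIndex, map_sum, Finset.sum_eq_zero, smul_zero]
    intro q hq
    have hb : b.nbrs = {q} := by
      obtain ⟨a, ha⟩ := Finset.card_eq_one.1 b.isIndex.2.2
      rw [ha] at hq ⊢
      rw [Finset.mem_singleton.1 hq]
    have hqN := b.isIndex.2.1 q hq
    rw [hb, Finset.erase_singleton, meetFamily, Finset.image_empty, map_smul, map_sub, map_smul,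
      map_smul, augmentation_basisElt K b.isIndex.1, augmentation_basisElt K hqN.1]
    simp only [inversions, Finset.empty_product, Finset.filter_empty, Finset.card_empty, pow_zero,
      mul_one, smul_eq_mul]
    rw [monY_mul_u K hqN.2.1.1, sub_self, mul_zero]

end Differential

/-! ### Exponent vectors and least common multiples -/

section Monomials

variable {n : ℕ}

/-- The exponent vector of `X_A`. -/
def expX (A : Finset (Fin n)) : Fin n ⊕ Fin n →₀ ℕ :=
  Finsupp.equivFunOnFinite.symm (Sum.elim (fun i => if i ∈ A then 1 else 0) fun _ => 0)

/-- The exponent vector of `Y_A`. -/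
def expY (A : Finset (Fin n)) : Fin n ⊕ Fin n →₀ ℕ :=
  Finsupp.equivFunOnFinite.symm (Sum.elim (fun _ => 0) fun i => if i ∈ A then 1 else 0)

@[simp] theorem expX_inl (A : Finset (Fin n)) (i : Fin n) :
    expX A (Sum.inl i) = if i ∈ A then 1 else 0 := rfl

@[simp] theorem expX_inr (A : Finset (Fin n)) (i : Fin n) : expX A (Sum.inr i) = 0 := rfl

@[simp] theorem expY_inl (A : Finset (Fin n)) (i : Fin n) : expY A (Sum.inl i) = 0 := rfl

@[simp] theorem expY_inr (A : Finset (Fin n)) (i : Fin n) :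
    expY A (Sum.inr i) = if i ∈ A then 1 else 0 := rfl

@[simp] theorem uExp_inl (p : Finset (Fin n)) (i : Fin n) :
    uExp p (Sum.inl i) = if i ∈ p then 1 else 0 := rfl

@[simp] theorem uExp_inr (p : Finset (Fin n)) (i : Fin n) :
    uExp p (Sum.inr i) = if i ∈ p then 0 else 1 := rfl

variable (K : Type*) [Field K]

theorem monX_eq (A : Finset (Fin n)) : monX K A = monomial (expX A) 1 := by
  rw [monX, show expX A = ∑ i ∈ A, Finsupp.single (Sum.inl i) 1 from ?_,
    monomial_sum_one]
  · rfl
  · ext v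
    rcases v with v | v <;> simp [Finsupp.finsetSum_apply, Finsupp.single_apply]

theorem monY_eq (A : Finset (Fin n)) : monY K A = monomial (expY A) 1 := by
  rw [monY, show expY A = ∑ i ∈ A, Finsupp.single (Sum.inr i) 1 from ?_,
    monomial_sum_one]
  · rfl
  · ext v
    rcases v with v | v <;> simp [Finsupp.finsetSum_apply, Finsupp.single_apply]

theorem u_eq (p : Finset (Fin n)) : u K p = monomial (uExp p) 1 := by
  rw [u, monX_eq, monY_eq, monomial_mul, one_mul]
  congr 2
  ext v
  rcases v with v | v <;> simp

variable {K}

theorem sup_uExp_inl {p : Finset (Fin n)} {S : Finset (Finset (Fin n))} (h : ∀ q ∈ S, q ⊆ p)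
    (i : Fin n) : (uExp p ⊔ S.sup uExp) (Sum.inl i) = if i ∈ p then 1 else 0 := by
  induction S using Finset.induction_on with
  | empty => simp
  | insert q S hq ih =>
    rw [Finset.sup_insert, sup_left_comm, Finsupp.sup_apply,
      ih fun r hr => h r (Finset.mem_insert_of_mem hr), uExp_inl]
    have := @h q (Finset.mem_insert_self _ _) i
    split_ifs <;> simp_all

theorem sup_uExp_inr (p : Finset (Fin n)) (S : Finset (Finset (Fin n))) (i : Fin n) :
    (uExp p ⊔ S.sup uExp) (Sum.inr i) = if i ∈ p ∧ ∀ q ∈ S, i ∈ q then 0 else 1 := by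
  induction S using Finset.induction_on with
  | empty => simp
  | insert q S hq ih =>
    rw [Finset.sup_insert, sup_left_comm, Finsupp.sup_apply, ih, uExp_inr]
    simp only [Finset.forall_mem_insert]
    split_ifs <;> simp_all

variable {L : Set (Finset (Fin n))} {i : ℕ} {p q : Finset (Fin n)}
  {S : Finset (Finset (Fin n))}

/-- The Y-part of the least common multiple is the complement of the intersection of p and all
elements of S. As p ∖ q lies in every other r ∈ S, deleting q loses exactly Y_{p∖q}. -/
theorem IsSetLattice.expY_add_sup (hL : IsSetLattice L) (h : IsIndex L (i + 1) p S) (hq : q ∈ S) :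
    expY (p \ q) + (uExp p ⊔ (S.erase q).sup uExp) = uExp p ⊔ S.sup uExp := by
  have hsub : ∀ r ∈ S, r ⊆ p := fun r hr => (h.2.1 r hr).2.1.1
  ext v
  rw [Finsupp.add_apply]
  rcases v with v | v
  · rw [sup_uExp_inl hsub, sup_uExp_inl fun r hr => hsub r (Finset.mem_of_mem_erase hr), expY_inl,
      zero_add]
  · rw [sup_uExp_inr, sup_uExp_inr, expY_inr]
    by_cases hv : v ∈ p \ q
    · have h1 : v ∈ p ∧ ∀ r ∈ S.erase q, v ∈ r := by
        refine ⟨(Finset.mem_sdiff.1 hv).1, fun r hr => ?_⟩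
        rw [Finset.mem_erase] at hr
        exact hL.sdiff_subset (h.2.1 r hr.2) (h.2.1 q hq) hr.1 hv
      rw [if_pos hv, if_pos h1, if_neg fun h2 => (Finset.mem_sdiff.1 hv).2 (h2.2 q hq)]
    · rw [if_neg hv, zero_add]
      congr 1
      refine propext (and_congr_right fun hp => ⟨fun h1 r hr => ?_, fun h1 r hr =>
        h1 r (Finset.mem_of_mem_erase hr)⟩)
      by_cases hrq : r = q
      · subst hrq
        by_contra h2
        exact hv (Finset.mem_sdiff.2 ⟨hp, h2⟩)
      · exact h1 r (Finset.mem_erase.2 ⟨hrq, hr⟩)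

/-- Passing to q and q ∧ (S ∖ {q}) leaves the total intersection, hence the Y-part, unchanged; the
X-part drops from p to q. -/
theorem expX_add_sup (h : IsIndex L (i + 1) p S) (hq : q ∈ S) :
    expX (p \ q) + (uExp q ⊔ (meetFamily q (S.erase q)).sup uExp) = uExp p ⊔ S.sup uExp := by
  have hsub : ∀ r ∈ S, r ⊆ p := fun r hr => (h.2.1 r hr).2.1.1
  have hsub' : ∀ r ∈ meetFamily q (S.erase q), r ⊆ q := by
    intro r hr
    obtain ⟨t, _, rfl⟩ := Finset.mem_image.1 hr
    exact Finset.inter_subset_left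
  ext v
  rw [Finsupp.add_apply]
  rcases v with v | v
  · rw [sup_uExp_inl hsub, sup_uExp_inl hsub', expX_inl]
    have := @hsub q hq v
    simp only [Finset.mem_sdiff]
    split_ifs <;> tauto
  · rw [sup_uExp_inr, sup_uExp_inr, expX_inr, zero_add]
    congr 1
    refine propext ⟨fun h1 => ⟨hsub q hq h1.1, fun r hr => ?_⟩, fun h1 => ⟨h1.2 q hq, ?_⟩⟩
    · by_cases hrq : r = q
      · exact hrq ▸ h1.1
      · exact (Finset.mem_inter.1 (h1.2 _ (Finset.mem_image_of_mem _
          (Finset.mem_erase.2 ⟨hrq, hr⟩)))).2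
    · intro r hr
      obtain ⟨t, ht, rfl⟩ := Finset.mem_image.1 hr
      exact Finset.mem_inter.2 ⟨h1.2 q hq, h1.2 t (Finset.mem_of_mem_erase ht)⟩

end Monomials

/-! ### Multidegrees, minimality and the image of the augmentation -/

section Grading

variable {K : Type*} [Field K] {n : ℕ} {L : Set (Finset (Fin n))}
  {prec : Finset (Fin n) → Finset (Fin n) → Prop} {i : ℕ}

/-- `z` is homogeneous of multidegree `δ`. -/
def IsHomogeneousElt (z : FreeMod K L i) (δ : Fin n ⊕ Fin n →₀ ℕ) : Prop :=
  ∀ c, ∀ m ∈ (z c).support, m + multideg L i c = δ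

theorem IsHomogeneousElt.sub {z w : FreeMod K L i} {δ : Fin n ⊕ Fin n →₀ ℕ}
    (hz : IsHomogeneousElt z δ) (hw : IsHomogeneousElt w δ) : IsHomogeneousElt (z - w) δ := by
  classical
  intro c m hm
  rw [Finsupp.sub_apply] at hm
  rcases Finset.mem_union.1 (support_sub _ _ _ hm) with h | h
  · exact hz c m h
  · exact hw c m h

theorem IsHomogeneousElt.neg_one_pow_smul {z : FreeMod K L i} {δ : Fin n ⊕ Fin n →₀ ℕ}
    (hz : IsHomogeneousElt z δ) (k : ℕ) :
    IsHomogeneousElt ((-1 : MvPolynomial (Fin n ⊕ Fin n) K) ^ k • z) δ := by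
  rcases neg_one_pow_eq_or (MvPolynomial (Fin n ⊕ Fin n) K) k with h | h <;> rw [h]
  · rwa [one_smul]
  · intro c m hm
    rw [neg_smul, one_smul, Finsupp.neg_apply, support_neg] at hm
    exact hz c m hm

theorem IsHomogeneousElt.sum {ι : Type*} {s : Finset ι} {f : ι → FreeMod K L i}
    {δ : Fin n ⊕ Fin n →₀ ℕ} (h : ∀ a ∈ s, IsHomogeneousElt (f a) δ) :
    IsHomogeneousElt (∑ a ∈ s, f a) δ := by
  classical
  intro c m hm
  rw [Finsupp.finsetSum_apply] at hm
  obtain ⟨a, ha, hm'⟩ := Finset.mem_biUnion.1 (support_sum hm)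
  exact h a ha c m hm'

theorem isHomogeneousElt_monomial_smul {p : Finset (Fin n)} {S : Finset (Finset (Fin n))}
    (h : IsIndex L i p S) (e : Fin n ⊕ Fin n →₀ ℕ) :
    IsHomogeneousElt (monomial e (1 : K) • basisElt K L i p S) (e + (uExp p ⊔ S.sup uExp)) := by
  classical
  intro c m hm
  rw [basisElt_of_isIndex K h, Finsupp.smul_apply, Finsupp.single_apply] at hm
  split_ifs at hm with hc
  · rw [smul_eq_mul, mul_one, support_monomial, if_neg one_ne_zero, Finset.mem_singleton] at hm
    rw [hm, ← hc]
    rfl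
  · simp at hm

theorem IsSetLattice.isHomogeneousElt_boundary (hL : IsSetLattice L) {p : Finset (Fin n)}
    {S : Finset (Finset (Fin n))} (h : IsIndex L (i + 1) p S) :
    IsHomogeneousElt (boundary K L prec i p S) (uExp p ⊔ S.sup uExp) := by
  rw [hL.boundary_eq K prec h]
  refine IsHomogeneousElt.sum fun q hq => IsHomogeneousElt.neg_one_pow_smul
    (IsHomogeneousElt.sub ?_ ?_) _
  · rw [monY_eq, ← hL.expY_add_sup h hq]
    exact isHomogeneousElt_monomial_smul (h.erase hq) _
  · rw [monX_eq, ← expX_add_sup h hq, mul_comm, mul_smul]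
    exact (isHomogeneousElt_monomial_smul (h.meetFamily hL hq) _).neg_one_pow_smul _

theorem monX_mem_span {A : Finset (Fin n)} (h : A.Nonempty) :
    monX K A ∈ Ideal.span (Set.range (X : _ → MvPolynomial (Fin n ⊕ Fin n) K)) := by
  obtain ⟨a, ha⟩ := h
  exact Ideal.mem_of_dvd _ (Finset.dvd_prod_of_mem _ ha) (Ideal.subset_span ⟨_, rfl⟩)

theorem monY_mem_span {A : Finset (Fin n)} (h : A.Nonempty) :
    monY K A ∈ Ideal.span (Set.range (X : _ → MvPolynomial (Fin n ⊕ Fin n) K)) := by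
  obtain ⟨a, ha⟩ := h
  exact Ideal.mem_of_dvd _ (Finset.dvd_prod_of_mem _ ha) (Ideal.subset_span ⟨_, rfl⟩)

theorem IsSetLattice.range_differential_le (hL : IsSetLattice L) :
    LinearMap.range (differential K L prec i) ≤
      Ideal.span (Set.range (X : _ → MvPolynomial (Fin n ⊕ Fin n) K)) • ⊤ := by
  rw [differential, Finsupp.range_linearCombination, Submodule.span_le]
  rintro _ ⟨b, rfl⟩
  have h := b.isIndex
  simp only [SetLike.mem_coe]
  rw [hL.boundary_eq K prec h]
  refine Submodule.sum_mem _ fun q hq => Submodule.smul_mem _ _ (Submodule.sub_mem _ ?_ ?_)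
  · exact Submodule.smul_mem_smul (monY_mem_span (sdiff_nonempty_of_mem (h.2.1 q hq))) trivial
  · exact Submodule.smul_mem_smul (Ideal.mul_mem_right _ _
      (monX_mem_span (sdiff_nonempty_of_mem (h.2.1 q hq)))) trivial

theorem range_augmentation : LinearMap.range (augmentation K L) = hibiIdeal K L := by
  rw [augmentation, Finsupp.range_linearCombination, hibiIdeal, Ideal.span]
  congr 1
  ext f
  constructor
  · rintro ⟨b, rfl⟩
    exact ⟨b.pt, b.isIndex.1, rfl⟩
  · rintro ⟨p, hp, rfl⟩
    exact ⟨Index.mk p ∅ ⟨hp, by simp, rfl⟩, rfl⟩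

theorem eq_multideg_of_mem_support_augmentation (b : Index L 0) (m : Fin n ⊕ Fin n →₀ ℕ)
    (hm : m ∈ (augmentation K L (Finsupp.single b 1)).support) : m = multideg L 0 b := by
  classical
  rw [augmentation_single, one_mul, u_eq, support_monomial, if_neg one_ne_zero,
    Finset.mem_singleton] at hm
  have h : b.nbrs = ∅ := Finset.card_eq_zero.1 b.isIndex.2.2
  change m = uExp b.pt ⊔ b.nbrs.sup uExp
  rw [h, Finset.sup_empty, sup_bot_eq, hm]

end Grading

/-! ### Exactness by division at maximal elements of the support -/

section Exactness

variable {K : Type*} [Field K] {n : ℕ} {L : Set (Finset (Fin n))}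
  {prec : Finset (Fin n) → Finset (Fin n) → Prop} {i : ℕ}

variable (K L) in
open Classical in
/-- The coefficient of `b(p;S)`; zero if `(p, S)` is not an index in degree `i`. -/
def coef (i : ℕ) (p : Finset (Fin n)) (S : Finset (Finset (Fin n))) :
    FreeMod K L i →ₗ[MvPolynomial (Fin n ⊕ Fin n) K] MvPolynomial (Fin n ⊕ Fin n) K :=
  if h : IsIndex L i p S then Finsupp.lapply (Index.mk p S h) else 0

variable {p q : Finset (Fin n)} {S : Finset (Finset (Fin n))}

theorem coef_of_isIndex (h : IsIndex L i p S) (z : FreeMod K L i) :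
    coef K L i p S z = z (Index.mk p S h) := by
  rw [coef, dif_pos h]
  rfl

theorem coef_of_not_isIndex (h : ¬ IsIndex L i p S) (z : FreeMod K L i) :
    coef K L i p S z = 0 := by
  rw [coef, dif_neg h]
  rfl

theorem apply_eq_coef (z : FreeMod K L i) (b : Index L i) : z b = coef K L i b.pt b.nbrs z :=
  (coef_of_isIndex b.isIndex z).symm

theorem coef_basisElt (h : IsIndex L i p S) (p' : Finset (Fin n))
    (S' : Finset (Finset (Fin n))) :
    coef K L i p S (basisElt K L i p' S') = if p' = p ∧ S' = S then 1 else 0 := by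
  classical
  rw [coef_of_isIndex h]
  by_cases h' : IsIndex L i p' S'
  · rw [basisElt_of_isIndex K h', Finsupp.single_apply]
    congr 1
    refine propext ⟨fun e => ⟨congrArg Index.pt e, congrArg Index.nbrs e⟩, fun e =>
      Index.ext e.1 e.2⟩
  · rw [basisElt, dif_neg h', if_neg]
    · rfl
    · rintro ⟨rfl, rfl⟩
      exact h' h

/-- `p` is a maximal element of the order ideal `D` of `L`. -/
structure IsTop (L : Set (Finset (Fin n))) (D : Finset (Finset (Fin n))) (p : Finset (Fin n)) :
    Prop where
  subset : ∀ r ∈ D, r ∈ L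
  lower : ∀ r ∈ D, ∀ t ∈ L, t ⊆ r → t ∈ D
  mem : p ∈ D
  maximal : ∀ r ∈ D, p ⊆ r → r = p

/-- `z` is a combination of the `b(p;S)` with `p ∈ D`. -/
def SupportedOn (D : Finset (Finset (Fin n))) (z : FreeMod K L i) : Prop :=
  ∀ p S, coef K L i p S z ≠ 0 → p ∈ D

theorem SupportedOn.sub {D : Finset (Finset (Fin n))} {z w : FreeMod K L i}
    (hz : SupportedOn D z) (hw : SupportedOn D w) : SupportedOn D (z - w) := by
  intro p S h
  by_contra hp
  rw [map_sub, not_not.1 fun h' => hp (hz p S h'), not_not.1 fun h' => hp (hw p S h'),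
    sub_zero] at h
  exact h rfl

theorem SupportedOn.induction {D : Finset (Finset (Fin n))} {P : FreeMod K L i → Prop}
    (zero : P 0) (add : ∀ x y, P x → P y → P (x + y))
    (smul : ∀ (c : MvPolynomial (Fin n ⊕ Fin n) K) p S, p ∈ D → IsIndex L i p S →
      P (c • basisElt K L i p S))
    {z : FreeMod K L i} (hz : SupportedOn D z) : P z := by
  rw [← Finsupp.sum_single z]
  refine Finset.sum_induction _ P add zero fun b hb => ?_
  have h := smul (z b) b.pt b.nbrs (hz b.pt b.nbrs ?_) b.isIndex
  · rwa [basisElt_of_isIndex K b.isIndex, Finsupp.smul_single, smul_eq_mul, mul_one] at h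
  · rw [← apply_eq_coef]
    exact Finsupp.mem_support_iff.1 hb

/-- The boundary of b(p;S) involves only p and lower neighbours of p. -/
theorem supportedOn_differential {D : Finset (Finset (Fin n))} (hL : IsSetLattice L)
    (hD : ∀ r ∈ D, ∀ t ∈ L, t ⊆ r → t ∈ D) {z : FreeMod K L (i + 1)} (hz : SupportedOn D z) :
    SupportedOn D (differential K L prec i z) := by
  refine SupportedOn.induction (P := fun z => SupportedOn D (differential K L prec i z))
    ?_ ?_ ?_ hz
  · intro p S h
    simp at h
  · intro x y hx hy p S h
    by_contra hp
    rw [map_add, map_add, not_not.1 fun h' => hp (hx p S h'), not_not.1 fun h' => hp (hy p S h'),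
      add_zero] at h
    exact h rfl
  · intro c p S hp hS r T h
    by_contra hr
    have hT : IsIndex L i r T := by
      by_contra hT
      exact h (coef_of_not_isIndex hT _)
    rw [map_smul, map_smul, differential_basisElt K prec hS, hL.boundary_eq K prec hS, map_sum,
      Finset.sum_eq_zero, smul_zero] at h
    · exact h rfl
    · intro q hq
      have hqN := hS.2.1 q hq
      rw [map_smul, map_sub, map_smul, map_smul, coef_basisElt hT, coef_basisElt hT,
        if_neg fun h : p = r ∧ _ => hr (h.1 ▸ hp),
        if_neg fun h : q = r ∧ _ => hr (h.1 ▸ hD p hp q hqN.1 hqN.2.1.1)]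
      simp

/-- The lower neighbours as a finite set. -/
def nbrFinset (L : Set (Finset (Fin n))) (p : Finset (Fin n)) : Finset (Finset (Fin n)) :=
  (Set.toFinite (lowerNeighbors L p)).toFinset

theorem mem_nbrFinset : q ∈ nbrFinset L p ↔ q ∈ lowerNeighbors L p :=
  Set.Finite.mem_toFinset _

theorem IsIndex.insert (h : IsIndex L i p S) (hq : q ∈ lowerNeighbors L p) (hqS : q ∉ S) :
    IsIndex L (i + 1) p (insert q S) :=
  ⟨h.1, Finset.forall_mem_insert .. |>.2 ⟨hq, h.2.1⟩, by
    rw [Finset.card_insert_of_notMem hqS, h.2.2]⟩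

/-- At a maximal element of its support, the differential is that of a Koszul complex. -/
theorem IsTop.coef_differential {D : Finset (Finset (Fin n))} (hD : IsTop L D p)
    (hL : IsSetLattice L) {z : FreeMod K L (i + 1)} (hz : SupportedOn D z) (hS : IsIndex L i p S) :
    coef K L i p S (differential K L prec i z) =
      ∑ q ∈ nbrFinset L p \ S, (-1) ^ sigma prec q (insert q S) *
        (monY K (p \ q) * coef K L (i + 1) p (insert q S) z) := by
  refine SupportedOn.induction (P := fun z => coef K L i p S (differential K L prec i z) =
      ∑ q ∈ nbrFinset L p \ S, (-1) ^ sigma prec q (insert q S) *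
        (monY K (p \ q) * coef K L (i + 1) p (insert q S) z)) ?_ ?_ ?_ hz
  · simp
  · intro x y hx hy
    simp only [map_add, hx, hy, mul_add, Finset.sum_add_distrib]
  · intro c r T hr hT
    simp only [map_smul, smul_eq_mul]
    rw [differential_basisElt K prec hT, hL.boundary_eq K prec hT, map_sum, Finset.mul_sum]
    -- The X-terms land at lower neighbours of elements of D, hence never at the maximal element p.
    have h1 : ∀ q ∈ T, q ≠ p := by
      rintro q hq rfl
      have hqN := hT.2.1 q hq
      exact hqN.2.1.ne (hD.maximal r hr hqN.2.1.1).symm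
    have hl : ∀ q ∈ T, c * coef K L i p S ((-1 : MvPolynomial (Fin n ⊕ Fin n) K) ^ sigma prec q T •
        (monY K (r \ q) • basisElt K L i r (T.erase q) -
          (monX K (r \ q) * (-1) ^ inversions prec q (T.erase q)) •
            basisElt K L i q (meetFamily q (T.erase q)))) =
        if r = p ∧ T.erase q = S then c * ((-1) ^ sigma prec q T * monY K (r \ q)) else 0 := by
      intro q hq
      rw [map_smul, map_sub, map_smul, map_smul, coef_basisElt hS, coef_basisElt hS,
        if_neg (fun h : q = p ∧ _ => h1 q hq h.1)]
      split_ifs <;> simp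
    have hr' : ∀ q ∈ nbrFinset L p \ S, (-1) ^ sigma prec q (insert q S) *
        (monY K (p \ q) * (c * coef K L (i + 1) p (insert q S) (basisElt K L (i + 1) r T))) =
        if r = p ∧ T = insert q S then c * ((-1) ^ sigma prec q T * monY K (r \ q)) else 0 := by
      intro q hq
      rw [Finset.mem_sdiff, mem_nbrFinset] at hq
      rw [coef_basisElt (hS.insert hq.1 hq.2)]
      split_ifs with h
      · rw [h.1, h.2]; ring
      · simp
    rw [Finset.sum_congr rfl hl, Finset.sum_congr rfl hr', ← Finset.sum_filter,
      ← Finset.sum_filter]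
    refine Finset.sum_congr ?_ fun _ _ => rfl
    ext q
    simp only [Finset.mem_filter, Finset.mem_sdiff, mem_nbrFinset]
    constructor
    · rintro ⟨hq, rfl, rfl⟩
      exact ⟨⟨hT.2.1 q hq, Finset.notMem_erase _ _⟩, rfl, (Finset.insert_erase hq).symm⟩
    · rintro ⟨⟨hq, hqS⟩, rfl, rfl⟩
      exact ⟨Finset.mem_insert_self _ _, rfl, Finset.erase_insert hqS⟩

/-- `f` has no monomial divisible by `Y_A`. -/
def IsReduced (A : Finset (Fin n)) (f : MvPolynomial (Fin n ⊕ Fin n) K) : Prop :=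
  ∀ m, expY A ≤ m → coeff m f = 0

theorem IsReduced.of_support {A : Finset (Fin n)} {f g : MvPolynomial (Fin n ⊕ Fin n) K}
    (h : IsReduced A f) (hg : ∀ m, coeff m f = 0 → coeff m g = 0) : IsReduced A g :=
  fun m hm => hg m (h m hm)

/-- The monomials Y_A and Y_B share no variable, so multiplication by Y_B does not create
divisibility by Y_A. -/
theorem IsReduced.monY_mul {A B : Finset (Fin n)} {f : MvPolynomial (Fin n ⊕ Fin n) K}
    (h : IsReduced A f) (hAB : Disjoint A B) : IsReduced A (monY K B * f) := by
  intro m hm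
  rw [monY_eq, coeff_monomial_mul']
  split_ifs with hB
  · rw [one_mul]
    refine h _ fun v => ?_
    have hv := hm v
    rcases v with v | v
    · simp
    · rw [Finsupp.tsub_apply]
      simp only [expY_inr] at hv ⊢
      split_ifs with h1 h2
      · exact absurd h2 (Finset.disjoint_left.1 hAB h1)
      · simpa [h1] using hv
      all_goals omega
  · rfl

theorem neg_one_pow_mul_mul (k : ℕ) (f g : MvPolynomial (Fin n ⊕ Fin n) K) :
    (-1) ^ k * (f * ((-1) ^ k * g)) = f * g := by
  linear_combination (f * g) * sq_neg_one_pow (MvPolynomial (Fin n ⊕ Fin n) K) k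

variable (prec) in
open Classical in
/-- The sum of `±(z_S / Y_{p ∖ q}) b(p; S ∪ {q})` over all `S` with `q ∉ S`, where `z_S` is the
coefficient of `b(p;S)` in `z`. -/
def divElt (p q : Finset (Fin n)) (z : FreeMod K L i) : FreeMod K L (i + 1) :=
  haveI : Finite (Index L (i + 1)) :=
    inferInstanceAs (Finite {b : Finset (Fin n) × Finset (Finset (Fin n)) // IsIndex L (i + 1) b.1 b.2})
  Finsupp.equivFunOnFinite.symm fun b =>
    if b.pt = p ∧ q ∈ b.nbrs then (-1) ^ sigma prec q b.nbrs *
      (coef K L i p (b.nbrs.erase q) z).divMonomial (expY (p \ q)) else 0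

open Classical in
theorem coef_divElt (z : FreeMod K L i) {r : Finset (Fin n)} {T : Finset (Finset (Fin n))}
    (hT : IsIndex L (i + 1) r T) :
    coef K L (i + 1) r T (divElt prec p q z) =
      if r = p ∧ q ∈ T then (-1) ^ sigma prec q T *
        (coef K L i p (T.erase q) z).divMonomial (expY (p \ q)) else 0 := by
  rw [coef_of_isIndex hT]
  rfl

theorem IsTop.supportedOn_divElt {D : Finset (Finset (Fin n))} (hD : IsTop L D p)
    (z : FreeMod K L i) : SupportedOn D (divElt prec p q z) := by
  intro r T h
  have hT : IsIndex L (i + 1) r T := by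
    by_contra hT
    exact h (coef_of_not_isIndex hT _)
  rw [coef_divElt z hT] at h
  split_ifs at h with h'
  · exact h'.1 ▸ hD.mem
  · exact absurd rfl h

/-- All sets occurring in `divElt` contain q. Hence in the Koszul sum at S ∌ q only the term of S ∪
{q} survives, and its sign occurs twice. Subtracting this boundary replaces the coefficient by its
remainder modulo Y_{p∖q}. -/
theorem IsTop.coef_differential_divElt {D : Finset (Finset (Fin n))} (hD : IsTop L D p)
    (hL : IsSetLattice L) (hq : q ∈ lowerNeighbors L p) (z : FreeMod K L i) (hqS : q ∉ S) :
    coef K L i p S (differential K L prec i (divElt prec p q z)) =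
      monY K (p \ q) * (coef K L i p S z).divMonomial (expY (p \ q)) := by
  by_cases hS : IsIndex L i p S
  · rw [hD.coef_differential hL (hD.supportedOn_divElt z) hS, Finset.sum_eq_single q]
    · rw [coef_divElt z (hS.insert hq hqS), if_pos ⟨rfl, Finset.mem_insert_self _ _⟩,
        Finset.erase_insert hqS, neg_one_pow_mul_mul]
    · intro r hr hne
      rw [Finset.mem_sdiff, mem_nbrFinset] at hr
      rw [coef_divElt z (hS.insert hr.1 hr.2), if_neg, mul_zero, mul_zero]
      exact fun h => (Finset.mem_insert.1 h.2).elim (fun h => hne h.symm) hqS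
    · exact fun h => absurd (Finset.mem_sdiff.2 ⟨mem_nbrFinset.2 hq, hqS⟩) h
  · rw [coef_of_not_isIndex hS, coef_of_not_isIndex hS, zero_divMonomial, mul_zero]

/-- Division by Y_{p∖q} does not spoil the vanishing already obtained at the sets containing an
earlier neighbour t. -/
theorem IsTop.coef_differential_divElt_eq_zero {D : Finset (Finset (Fin n))} (hD : IsTop L D p)
    (hL : IsSetLattice L) (z : FreeMod K L i) {t : Finset (Fin n)}
    (hz : ∀ T, t ∈ T → coef K L i p T z = 0) (hqt : q ≠ t) (htS : t ∈ S) :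
    coef K L i p S (differential K L prec i (divElt prec p q z)) = 0 := by
  by_cases hS : IsIndex L i p S
  · rw [hD.coef_differential hL (hD.supportedOn_divElt z) hS]
    refine Finset.sum_eq_zero fun r hr => ?_
    rw [Finset.mem_sdiff, mem_nbrFinset] at hr
    rw [coef_divElt z (hS.insert hr.1 hr.2), hz _ (Finset.mem_erase.2
      ⟨hqt.symm, Finset.mem_insert_of_mem htS⟩), zero_divMonomial]
    simp
  · exact coef_of_not_isIndex hS _

/-- In a cycle whose coefficients at the `S` without `q` are reduced modulo `Y_{p ∖ q}`, the
coefficients at the `S` with `q` vanish. -/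
theorem IsTop.coef_eq_zero_of_reduced {D : Finset (Finset (Fin n))} (hD : IsTop L D p)
    (hL : IsSetLattice L) {z : FreeMod K L (i + 1)} (hz : SupportedOn D z)
    (hdz : differential K L prec i z = 0) (hq : q ∈ lowerNeighbors L p)
    (hred : ∀ S, q ∉ S → IsReduced (p \ q) (coef K L (i + 1) p S z)) (hqS : q ∈ S) :
    coef K L (i + 1) p S z = 0 := by
  by_cases hS : IsIndex L (i + 1) p S
  swap
  · exact coef_of_not_isIndex hS _
  have hT := hS.erase hqS
  have h := hD.coef_differential (prec := prec) hL hz hT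
  rw [hdz, map_zero, ← Finset.add_sum_erase _ _ (Finset.mem_sdiff.2
    ⟨mem_nbrFinset.2 hq, Finset.notMem_erase q S⟩), Finset.insert_erase hqS] at h
  -- The cycle condition at S ∖ {q} reads ±Y_{p∖q} z_S + rest = 0. The sets in the rest avoid q, and
  -- their factors Y_{p∖r} are coprime to Y_{p∖q}, so the rest has no monomial divisible by Y_{p∖q}.
  have hrest : IsReduced (p \ q) (∑ r ∈ (nbrFinset L p \ S.erase q).erase q,
      (-1) ^ sigma prec r (insert r (S.erase q)) *
        (monY K (p \ r) * coef K L (i + 1) p (insert r (S.erase q)) z)) := by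
    intro m hm
    rw [coeff_sum]
    refine Finset.sum_eq_zero fun r hr => ?_
    simp only [Finset.mem_erase, Finset.mem_sdiff, mem_nbrFinset] at hr
    have hr' : IsReduced (p \ q) (monY K (p \ r) * coef K L (i + 1) p (insert r (S.erase q)) z) :=
      (hred _ (by simp [Ne.symm hr.1])).monY_mul (hL.disjoint_sdiff hq hr.2.1 (Ne.symm hr.1))
    rcases neg_one_pow_eq_or (MvPolynomial (Fin n ⊕ Fin n) K)
      (sigma prec r (insert r (S.erase q))) with h | h <;> rw [h]
    · rw [one_mul, hr' m hm]
    · rw [neg_one_mul, coeff_neg, hr' m hm, neg_zero]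
  ext m
  have h1 := congrArg (coeff (expY (p \ q) + m)) h
  rw [coeff_add, hrest _ le_self_add, add_zero, coeff_zero] at h1
  rcases neg_one_pow_eq_or (MvPolynomial (Fin n ⊕ Fin n) K) (sigma prec q S) with h2 | h2 <;>
    rw [h2] at h1
  · rw [one_mul, monY_eq, coeff_monomial_mul, one_mul] at h1
    rw [← h1, coeff_zero]
  · rw [neg_one_mul, coeff_neg, monY_eq, coeff_monomial_mul, one_mul] at h1
    rw [coeff_zero, ← neg_eq_zero, ← h1]

/-- A cycle in degree `0` without terms divisible by some `Y_{p ∖ q}` has no terms at `p`. -/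
theorem IsTop.coef_eq_zero_of_augmentation {D : Finset (Finset (Fin n))} (hD : IsTop L D p)
    (hL : IsSetLattice L) {z : FreeMod K L 0} (hz : SupportedOn D z)
    (haug : augmentation K L z = 0)
    (hred : ∀ q ∈ lowerNeighbors L p, IsReduced (p \ q) (coef K L 0 p ∅ z)) :
    coef K L 0 p ∅ z = 0 := by
  have hp : IsIndex L 0 p ∅ := ⟨hD.subset p hD.mem, by simp, rfl⟩
  ext m
  rw [coeff_zero]
  by_contra hm
  -- Suppose that m occurs in the coefficient at p. Another r in the support can contribute to this
  -- coefficient only if u_r divides the monomial m·u_p, so that Y_{p∖r} divides m. By maximality r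
  -- ∩ p ⊂ p, so r ∩ p lies below some q ∈ N(p) and Y_{p∖q} divides m, against reducedness.
  have h1 := congrArg (coeff (m + uExp p)) haug
  rw [augmentation, Finsupp.linearCombination_apply, Finsupp.sum, coeff_sum,
    Finset.sum_eq_single (Index.mk p ∅ hp), smul_eq_mul, u_eq, coeff_zero] at h1
  · rw [coef_of_isIndex hp] at hm
    have h2 := coeff_mul_monomial m (uExp p) (1 : K) (z (Index.mk p ∅ hp))
    rw [mul_one] at h2
    exact hm (h2.symm.trans h1)
  · intro b hb hne
    have hbD : b.pt ∈ D := hz b.pt b.nbrs (by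
      rw [← apply_eq_coef]; exact Finsupp.mem_support_iff.1 hb)
    rw [smul_eq_mul, u_eq, coeff_mul_monomial', if_neg]
    intro hle
    have hss : b.pt ∩ p ⊂ p := by
      refine Finset.inter_subset_right.ssubset_of_ne fun h => hne ?_
      have h3 := hD.maximal _ hbD (Finset.inter_eq_right.1 h)
      exact Index.ext h3 (Finset.card_eq_zero.1 b.isIndex.2.2)
    obtain ⟨q, hq, hbq⟩ := exists_lowerNeighbor
      (hL.inter _ b.isIndex.1 _ (hD.subset p hD.mem)) hss
    refine hm (hred q hq m fun v => ?_)
    rcases v with v | v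
    · simp
    · have hv := hle (Sum.inr v)
      rw [expY_inr]
      split_ifs with h4
      · rw [Finset.mem_sdiff] at h4
        have h5 : v ∉ b.pt := fun h5 => h4.2 (hbq (Finset.mem_inter.2 ⟨h5, h4.1⟩))
        simpa [h5, h4.1] using hv
      · exact Nat.zero_le _
  · intro h
    rw [Finsupp.notMem_support_iff.1 h, zero_smul, coeff_zero]

/-- Let `C` be a class of elements of `F_i`, closed under subtraction of boundaries, with the
following properties at each maximal element `p` of the support. The coefficients at `S ∋ q` vanish
if those at the other `S` are reduced modulo `Y_{p ∖ q}`, and all coefficients vanish if they are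
reduced and only `S = ∅` is left. Then all elements of `C` are boundaries. -/
theorem mem_range_differential (hL : IsSetLattice L) (C : FreeMod K L i → Prop)
    (hC : ∀ z w, C z → C (z - differential K L prec i w))
    (hstep : ∀ D p q S, IsTop L D p → ∀ z, C z → SupportedOn D z → q ∈ lowerNeighbors L p →
      (∀ S, q ∉ S → IsReduced (p \ q) (coef K L i p S z)) → q ∈ S → coef K L i p S z = 0)
    (hfinal : ∀ D p, IsTop L D p → ∀ z, C z → SupportedOn D z →
      (∀ q ∈ lowerNeighbors L p, ∀ S, q ∈ S → coef K L i p S z = 0) →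
      (∀ q ∈ lowerNeighbors L p, ∀ S, IsReduced (p \ q) (coef K L i p S z)) →
      ∀ S, coef K L i p S z = 0)
    (z : FreeMod K L i) (hz : C z) : ∃ w, differential K L prec i w = z := by
  -- The neighbours of p are treated one at a time; Q is the set of those already treated.
  have key : ∀ D p, IsTop L D p → ∀ z, C z → SupportedOn D z → ∀ Q ⊆ nbrFinset L p,
      ∃ w, SupportedOn D (z - differential K L prec i w) ∧
        (∀ q ∈ Q, ∀ S, q ∈ S → coef K L i p S (z - differential K L prec i w) = 0) ∧
        (∀ q ∈ Q, ∀ S, IsReduced (p \ q) (coef K L i p S (z - differential K L prec i w))) := by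
    intro D p hD z hz hzD Q
    induction Q using Finset.induction_on with
    | empty => exact fun _ => ⟨0, by simpa using hzD, by simp, by simp⟩
    | insert q Q hqQ ih =>
      intro hQ
      obtain ⟨w, hw, hw1, hw2⟩ := ih fun r hr => hQ (Finset.mem_insert_of_mem hr)
      have hq : q ∈ lowerNeighbors L p := mem_nbrFinset.1 (hQ (Finset.mem_insert_self _ _))
      set z' := z - differential K L prec i w with hz'
      have hz'' : z - differential K L prec i (w + divElt prec p q z') =
          z' - differential K L prec i (divElt prec p q z') := by
        rw [map_add, hz']; abel
      refine ⟨w + divElt prec p q z', ?_⟩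
      rw [hz'']
      have hmod : ∀ S, q ∉ S → coef K L i p S (z' - differential K L prec i (divElt prec p q z')) =
          (coef K L i p S z').modMonomial (expY (p \ q)) := by
        intro S hS
        rw [map_sub, hD.coef_differential_divElt hL hq z' hS, monY_eq, sub_eq_iff_eq_add]
        exact (modMonomial_add_divMonomial _ _).symm
      have hsupp : SupportedOn D (z' - differential K L prec i (divElt prec p q z')) :=
        hw.sub (supportedOn_differential hL hD.lower (hD.supportedOn_divElt z'))
      have hredq : ∀ S, q ∉ S → IsReduced (p \ q)
          (coef K L i p S (z' - differential K L prec i (divElt prec p q z'))) := by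
        intro S hS m hm
        rw [hmod S hS]
        exact coeff_modMonomial_of_le _ hm
      have hzero := fun S => hstep D p q S hD _ (hC _ _ (hC _ _ hz)) hsupp hq hredq
      refine ⟨hsupp, ?_, ?_⟩
      · refine Finset.forall_mem_insert .. |>.2 ⟨hzero, fun t ht S htS => ?_⟩
        rw [map_sub, hw1 t ht S htS, hD.coef_differential_divElt_eq_zero hL z' (hw1 t ht)
          (fun h : q = t => hqQ (h ▸ ht)) htS, sub_zero]
      · intro t ht S
        by_cases hS : q ∈ S
        · rw [hzero S hS]
          exact fun m _ => coeff_zero m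
        · rcases Finset.mem_insert.1 ht with rfl | ht
          · exact hredq S hS
          · rw [hmod S hS]
            -- Taking the remainder only deletes monomials, so reducedness for the earlier
            -- neighbours persists.
            refine (hw2 t ht S).of_support fun m hm => ?_
            by_cases hle : expY (p \ q) ≤ m
            · exact coeff_modMonomial_of_le _ hle
            · rw [coeff_modMonomial_of_not_le _ hle, hm]
  -- Once all coefficients at a maximal p vanish, the support lies in the smaller order ideal D ∖
  -- {p}.
  have main : ∀ k, ∀ D : Finset (Finset (Fin n)), D.card = k → (∀ r ∈ D, r ∈ L) →
      (∀ r ∈ D, ∀ t ∈ L, t ⊆ r → t ∈ D) → ∀ z, C z → SupportedOn D z →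
      ∃ w, differential K L prec i w = z := by
    intro k
    induction k with
    | zero =>
      intro D hD _ _ z _ hzD
      rw [Finset.card_eq_zero] at hD
      refine ⟨0, ?_⟩
      rw [map_zero]
      ext1 b
      rw [apply_eq_coef z]
      by_contra h
      have := hzD _ _ (Ne.symm h)
      simp [hD] at this
    | succ k ih =>
      intro D hcard hDL hlow z hz hzD
      obtain ⟨p, hp, hmax⟩ := D.exists_maximalFor id (Finset.card_pos.1 (by omega))
      have hD : IsTop L D p := ⟨hDL, hlow, hp, fun r hr hpr => (hmax hr hpr).antisymm hpr⟩
      obtain ⟨w, hw, hw1, hw2⟩ := key D p hD z hz hzD _ subset_rfl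
      have hzero := hfinal D p hD _ (hC _ w hz) hw
        (fun q hq => hw1 q (mem_nbrFinset.2 hq)) (fun q hq => hw2 q (mem_nbrFinset.2 hq))
      obtain ⟨w', hw'⟩ := ih (D.erase p) (by rw [Finset.card_erase_of_mem hp, hcard]; rfl)
        (fun r hr => hDL r (Finset.mem_of_mem_erase hr)) (fun r hr t ht htr => by
          rw [Finset.mem_erase] at hr
          refine Finset.mem_erase.2 ⟨?_, hlow r hr.2 t ht htr⟩
          rintro rfl
          exact hr.1 (hD.maximal r hr.2 htr)) _ (hC _ w hz) (fun r S h => by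
          refine Finset.mem_erase.2 ⟨?_, hw r S h⟩
          rintro rfl
          exact h (hzero S))
      exact ⟨w' + w, by rw [map_add, hw', sub_add_cancel]⟩
  refine main _ (Set.toFinite L).toFinset rfl (fun r hr => by simpa using hr)
    (fun r _ t ht _ => by simpa using ht) z hz fun p S h => ?_
  rw [Set.Finite.mem_toFinset]
  by_contra hp
  exact h (coef_of_not_isIndex (fun h => hp h.1) _)

/-- In positive degree every S is non-empty, so once the coefficients at all S containing a
neighbour of p vanish, nothing is left at p. -/
theorem IsSetLattice.exact_differential (hL : IsSetLattice L) (hprec : IsRankOrder L prec) :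
    Function.Exact (differential K L prec (i + 1)) (differential K L prec i) := by
  intro z
  constructor
  · refine mem_range_differential hL (fun z => differential K L prec i z = 0) ?_ ?_ ?_ z
    · intro z w hz
      rw [map_sub, hz, hL.differential_differential K hprec, sub_zero]
    · exact fun D p q S hD z hz hzD hq hred hqS =>
        hD.coef_eq_zero_of_reduced hL hzD hz hq hred hqS
    · intro D p hD z _ _ h _ S
      by_cases hS : IsIndex L (i + 1) p S
      · obtain ⟨q, hq⟩ := Finset.card_pos.1 (hS.2.2.symm ▸ Nat.succ_pos i : 0 < S.card)
        exact h q (hS.2.1 q hq) S hq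
      · exact coef_of_not_isIndex hS _
  · rintro ⟨w, rfl⟩
    exact hL.differential_differential K hprec w

/-- In degree 0 only S = ∅ occurs, so the step condition is vacuous and the augmentation handles the
remainder. -/
theorem IsSetLattice.exact_augmentation (hL : IsSetLattice L) :
    Function.Exact (differential K L prec 0) (augmentation K L) := by
  have hempty : ∀ {p S}, IsIndex L 0 p S → S = ∅ := fun h => Finset.card_eq_zero.1 h.2.2
  intro z
  constructor
  · refine mem_range_differential hL (fun z => augmentation K L z = 0) ?_ ?_ ?_ z
    · intro z w hz
      rw [map_sub, hz, hL.augmentation_differential K, sub_zero]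
    · intro D p q S _ z _ _ _ _ hqS
      refine coef_of_not_isIndex (fun hS => ?_) _
      rw [hempty hS] at hqS
      exact Finset.notMem_empty _ hqS
    · intro D p hD z hz hzD _ hred S
      by_cases hS : IsIndex L 0 p S
      · rw [hempty hS]
        exact hD.coef_eq_zero_of_augmentation hL hzD hz fun q hq => hred q hq ∅
      · exact coef_of_not_isIndex hS _
  · rintro ⟨w, rfl⟩
    exact hL.augmentation_differential K w

end Exactness

/-! ### The resolution and the compatible case -/

variable {K : Type*} [Field K] {n : ℕ} {L : Set (Finset (Fin n))}
  {prec : Finset (Fin n) → Finset (Fin n) → Prop}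

theorem IsSetLattice.isMinimalMultigradedFreeResolution (hL : IsSetLattice L)
    (hprec : IsRankOrder L prec) :
    IsMinimalMultigradedFreeResolution (hibiIdeal K L) (Index L) (multideg L)
      (differential K L prec) (augmentation K L) where
  range_aug := range_augmentation
  exact_zero := hL.exact_augmentation
  exact_succ _ := hL.exact_differential hprec
  multigraded_aug := eq_multideg_of_mem_support_augmentation
  multigraded i b c m hm := by
    rw [differential_single, one_smul] at hm
    exact hL.isHomogeneousElt_boundary b.isIndex c m hm
  minimal _ := hL.range_differential_le

/-- An inversion r ≺ s would have q ∩ s ≺ q ∩ r, while compatibility gives the opposite comparison.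
-/
theorem IsMeetCompatible.inversions_eq_zero (hcomp : IsMeetCompatible L prec)
    (hL : IsSetLattice L) (hprec : IsRankOrder L prec) {i : ℕ} {p q : Finset (Fin n)}
    {S : Finset (Finset (Fin n))} (h : IsIndex L i p S) (hq : q ∈ S) :
    inversions prec q (S.erase q) = 0 := by
  classical
  rw [inversions, Finset.card_eq_zero, Finset.filter_eq_empty_iff]
  rintro ⟨r, s⟩ hrs ⟨h1, h2⟩
  simp only [Finset.mem_product, Finset.mem_erase] at hrs
  have hqN := h.2.1 q hq
  have hrN := h.2.1 r hrs.1.2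
  have hsN := h.2.1 s hrs.2.2
  exact hprec.asymm (hL.inter _ hqN.1 _ hrN.1) (hL.inter _ hqN.1 _ hsN.1)
    (hcomp p h.1 q hqN r hrN s hsN (Ne.symm hrs.1.1) (Ne.symm hrs.2.1) h1) h2

end UnmixedBipartite

end

theorem theorem1p3 (K : Type*) [Field K] {n : ℕ} (G : SimpleGraph (Fin n ⊕ Fin n))
    (hG : UnmixedBipartite.IsUnmixedBipartite G)
    (L : Set (Finset (Fin n))) (hL : L = UnmixedBipartite.coverLattice G) :
    -- all basis elements in the formula exist
    (∀ i p S, UnmixedBipartite.IsIndex L (i + 1) p S → ∀ q ∈ S,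
      UnmixedBipartite.IsIndex L i p (S.erase q) ∧
      UnmixedBipartite.IsIndex L i q (UnmixedBipartite.meetFamily q (S.erase q))) ∧
    -- orders compatible with meets of lower neighbours exist
    (∃ prec, UnmixedBipartite.IsRankOrder L prec ∧ UnmixedBipartite.IsMeetCompatible L prec) ∧
    -- the resolution and its differential
    ∀ prec, UnmixedBipartite.IsRankOrder L prec →
      ∃ (d : ∀ i, UnmixedBipartite.FreeMod K L (i + 1)
            →ₗ[MvPolynomial (Fin n ⊕ Fin n) K] UnmixedBipartite.FreeMod K L i)
        (aug : UnmixedBipartite.FreeMod K L 0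
            →ₗ[MvPolynomial (Fin n ⊕ Fin n) K] MvPolynomial (Fin n ⊕ Fin n) K),
        UnmixedBipartite.IsMinimalMultigradedFreeResolution (UnmixedBipartite.hibiIdeal K L)
          (UnmixedBipartite.Index L) (UnmixedBipartite.multideg L) d aug ∧
        (∀ p ∈ L, aug (UnmixedBipartite.basisElt K L 0 p ∅) = UnmixedBipartite.u K p) ∧
        (∀ i p S, UnmixedBipartite.IsIndex L (i + 1) p S →
          d i (UnmixedBipartite.basisElt K L (i + 1) p S) =
            ∑ q ∈ S, (-1 : MvPolynomial (Fin n ⊕ Fin n) K) ^ UnmixedBipartite.sigma prec q S •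
              (UnmixedBipartite.monYS K p q S •
                  UnmixedBipartite.basisElt K L i p (S.erase q) -
                UnmixedBipartite.monX K (p \ q) •
                  UnmixedBipartite.orientedMeetElt K L prec i q (S.erase q))) ∧
        (UnmixedBipartite.IsMeetCompatible L prec →
          ∀ i p S, UnmixedBipartite.IsIndex L (i + 1) p S →
            d i (UnmixedBipartite.basisElt K L (i + 1) p S) =
              ∑ q ∈ S, (-1 : MvPolynomial (Fin n ⊕ Fin n) K) ^ UnmixedBipartite.sigma prec q S •
                (UnmixedBipartite.monYS K p q S •
                    UnmixedBipartite.basisElt K L i p (S.erase q) -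
                  UnmixedBipartite.monX K (p \ q) •
                    UnmixedBipartite.basisElt K L i q
                      (UnmixedBipartite.meetFamily q (S.erase q)))) := by
  subst hL
  have hL := hG.isSetLattice
  refine ⟨fun i p S h q hq => ⟨h.erase hq, h.meetFamily hL hq⟩,
    ⟨_, UnmixedBipartite.isRankOrder_rankColex _, hL.isMeetCompatible_rankColex⟩, fun prec hprec =>
    ⟨UnmixedBipartite.differential K _ prec, UnmixedBipartite.augmentation K _,
      hL.isMinimalMultigradedFreeResolution hprec,
      fun p hp => UnmixedBipartite.augmentation_basisElt K hp,
      fun i p S h => UnmixedBipartite.differential_basisElt K prec h, fun hcomp i p S h => ?_⟩⟩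
  rw [UnmixedBipartite.differential_basisElt K prec h]
  refine Finset.sum_congr rfl fun q hq => ?_
  rw [UnmixedBipartite.orientedMeetElt, hcomp.inversions_eq_zero hL hprec h hq, pow_zero, one_smul]
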